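/- **Setting.** Let $N\ge 0$ and let $T^*\mathbb R^N$ have coordinates $z=(x_1,\dots,x_N,p_1,\dots,p_N)$ and Poisson tensor $J=\left(\begin{smallmatrix}0&I\\-I&0\end{smallmatrix}\right)$. The constant $\hbar$ is a formal parameter. *Symbols* are elements of $C^\infty(T^*\mathbb R^N;\mathbb C)[[\hbar]]$; derivatives act on them coefficientwise. With summation over repeated indices, the Moyal product of symbols is $$C\star D=\sum_{k\ge0}\frac1{k!}\Big(\frac{i\hbar}2\Big)^k C_{,\mu^1\cdots\mu^k}\,J^{\mu^1\nu^1}\cdots J^{\mu^k\nu^k}\,D_{,\nu^1\cdots\nu^k}.$$ Composition of Weyl-quantized operators corresponds to $\star$ on their symbols. Let $A=A_0+\hbar A_1+\cdots$ be a symbol with $A_0$ real-valued. Let $\mathcal A$ be an algebra of smooth functions $\mathbb R\to\mathbb C$ (under pointwise operations, containing the constants) that contains the coordinate function $y$ and, with every $g$ such that $g(a)=0$ ($a\in\mathbb R$), the quotient $g(y)/(y-a)$; for example all smooth functions, all real-analytic functions, or all polynomials. Let $g\mapsto g(\widehat A)$ be a functional calculus on $\mathcal A$ for the operator $\widehat A$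 with symbol $A$. In terms of the symbols $\Phi(g)$ of $g(\widehat A)$, this means that $\Phi:\mathcal A\to C^\infty(T^*\mathbb R^N;\mathbb C)[[\hbar]]$ is $\mathbb C$-linear, $\Phi(1)=1$, $\Phi(gh)=\Phi(g)\star\Phi(h)$ and $\Phi(y)=A$. **Graphs.** A *labeled graph* with $V$ vertices and $E$ edges is a map $\Gamma$ from $\{1,\dots,E\}$ to the set of two-element subsets of $\{1,\dots,V\}$. Every edge is oriented from its endpoint with the lower label to its endpoint with the higher label. A *graph* $[\Gamma]$ is an orbit of the group $S_V\times S_E$ of relabelings, and $S_\Gamma$ is the order of the stabilizer of $\Gamma$ in this group. A graph is *reduced* if every vertex lies on an edge. Further, $$c_\Gamma=\sum_{\sigma\in S_V}(-1)^{\#\{\text{edges of }\Gamma\text{ whose orientation is inverted by the relabeling }\sigma\text{ of the vertices}\}} ,$$ and $\lambda_\Gamma(A)$ is obtained by placing a copy of $A$ at every vertex and a factor $J^{\mu\nu}$ on every edge, with $\partial_\mu$ acting on the copy of $A$ at the source of the edge and $\partial_\nu$ on the copy at its target, then multiplying all factors and summing over all indices. **Statement.** For every $f\in\mathcal A$, the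 symbol $B=\Phi(f)$ of $f(\widehat A)$ is $$B=\left[\exp\sum_{[\Gamma]}\Big(\frac{i\hbar}2\Big)^{E}\,\frac{c_\Gamma}{S_\Gamma}\,\lambda_\Gamma(A)\,\frac{D^V}{V!}\right]f(A),$$ where the sum is over all connected, reduced, non-empty graphs, with one (arbitrary) labeled representative $\Gamma$ chosen for each. Here $D$ is the derivative acting on $f$: it is treated as a formal variable commuting with functions on phase space, the exponential is computed as a formal power series in $\hbar$, and then each $D^v$ is replaced with $f^{(v)}(A)$. For $g$ smooth, $g(A)$ is the formal power series $\sum_{j\ge0}\frac1{j!}\,g^{(j)}(A_0)\,(A-A_0)^j$. -/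

import Mathlib

open scoped ContDiff

/-! ### Smooth functions and formal power series in `ħ` -/

/-- The complex algebra of complex-valued smooth functions on a real normed space. -/
def smoothFunctions (F : Type) [NormedAddCommGroup F] [NormedSpace ℝ F] :
    Subalgebra ℂ (F → ℂ) where
  carrier := {f | ContDiff ℝ ∞ f}
  mul_mem' := fun {f g} (hf : ContDiff ℝ ∞ f) (hg : ContDiff ℝ ∞ g) => hf.mul hg
  add_mem' := fun {f g} (hf : ContDiff ℝ ∞ f) (hg : ContDiff ℝ ∞ g) => hf.add hg
  algebraMap_mem' := fun c => show ContDiff ℝ ∞ fun _ : F => c from contDiff_const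

/-- The derivative of a smooth function in the direction `v`. -/
noncomputable def dirDeriv {F : Type} [NormedAddCommGroup F] [NormedSpace ℝ F] (v : F)
    (f : smoothFunctions F) : smoothFunctions F :=
  ⟨fun z => fderiv ℝ (f : F → ℂ) z v,
    (ContDiff.fderiv_right (m := ∞) (show ContDiff ℝ ∞ (f : F → ℂ) from f.2)
      le_rfl).clm_apply contDiff_const⟩

/-- The derivative `f'` of a smooth function `f : ℝ → ℂ`. -/
noncomputable def derivFn (f : smoothFunctions ℝ) : smoothFunctions ℝ := dirDeriv (1 : ℝ) f

/-- The coordinate function `y ↦ y` on `ℝ`. -/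
noncomputable def coordFn : smoothFunctions ℝ :=
  ⟨fun y => (y : ℂ), show ContDiff ℝ ∞ fun y : ℝ => (y : ℂ) from Complex.ofRealCLM.contDiff⟩

/-- The index set of the coordinates `z = (x, p)` of `T*ℝᴺ`: `Sum.inl j` is the index of `x_j` and
`Sum.inr j` that of `p_j`. -/
abbrev CoordIndex (N : ℕ) : Type := Fin N ⊕ Fin N

/-- The phase space `T*ℝᴺ`. -/
abbrev PhaseSpace (N : ℕ) : Type := CoordIndex N → ℝ

/-- Smooth functions on phase space. -/
abbrev ClassicalSymbol (N : ℕ) : Type := smoothFunctions (PhaseSpace N)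

/-- Symbols: formal power series in `ħ` (the variable of `PowerSeries`) whose coefficients are
smooth functions on phase space. -/
abbrev FormalSymbol (N : ℕ) : Type := PowerSeries (ClassicalSymbol N)

/-- The formal sum `∑ₖ ħᵏ Fₖ` of a sequence of power series `Fₖ` in `ħ`. -/
noncomputable def hbarSum {R : Type} [Semiring R] (F : ℕ → PowerSeries R) : PowerSeries R :=
  PowerSeries.mk fun n => ∑ k ∈ Finset.range (n + 1), PowerSeries.coeff (n - k) (F k)

/-! ### The Moyal product -/

/-- The Poisson tensor, with block matrix `(0 I; -I 0)`. -/
def poissonTensor (N : ℕ) : Matrix (CoordIndex N) (CoordIndex N) ℂ :=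
  Matrix.fromBlocks 0 1 (-1) 0

/-- The partial derivative `∂_μ` of a symbol, taken coefficientwise. -/
noncomputable def pderivSymbol {N : ℕ} (μ : CoordIndex N) (C : FormalSymbol N) : FormalSymbol N :=
  PowerSeries.mk fun n => dirDeriv (Pi.single μ (1 : ℝ)) (PowerSeries.coeff n C)

/-- The iterated partial derivative `∂_{μ₁} ⋯ ∂_{μₖ} C`. -/
noncomputable def iterPderiv {N : ℕ} (l : List (CoordIndex N)) (C : FormalSymbol N) :
    FormalSymbol N :=
  l.foldr pderivSymbol C

/-- `{C, D}ₖ = C_{,μ₁…μₖ} J^{μ₁ν₁} ⋯ J^{μₖνₖ} D_{,ν₁…νₖ}`. -/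
noncomputable def moyalBracket {N : ℕ} (k : ℕ) (C D : FormalSymbol N) : FormalSymbol N :=
  ∑ μ : Fin k → CoordIndex N, ∑ ν : Fin k → CoordIndex N,
    (∏ i, poissonTensor N (μ i) (ν i)) •
      (iterPderiv (List.ofFn μ) C * iterPderiv (List.ofFn ν) D)

/-- The Moyal product `C ⋆ D = ∑ₖ (1/k!) (iħ/2)ᵏ {C, D}ₖ`. -/
noncomputable def moyal {N : ℕ} (C D : FormalSymbol N) : FormalSymbol N :=
  hbarSum fun k => ((Complex.I / 2) ^ k / (k.factorial : ℂ)) • moyalBracket k C D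

/-! ### Functional calculus -/

/-- An algebra of smooth functions of a real variable that contains the coordinate function
(hence all polynomials) and the quotient `g(y) / (y - a)` whenever it contains `g` and
`g(a) = 0`. Examples: all smooth functions, all real-analytic functions, all polynomials. -/
structure IsFunctionAlgebra (𝒜 : Subalgebra ℂ (smoothFunctions ℝ)) : Prop where
  coord_mem : coordFn ∈ 𝒜
  div_mem : ∀ g ∈ 𝒜, ∀ a : ℝ, (g : ℝ → ℂ) a = 0 →
    ∃ h ∈ 𝒜, ∀ y : ℝ, (g : ℝ → ℂ) y = ((y : ℂ) - (a : ℂ)) * (h : ℝ → ℂ) y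

/-- `Φ g` is the symbol of `g(Â)`, where `A` is the symbol of `Â` and `g ↦ g(Â)` is a functional
calculus on `𝒜`, that is, a morphism of unital algebras with `y ↦ Â`. Composition of operators
corresponds to the Moyal product of symbols. -/
structure IsFunctionalCalculus {N : ℕ} (𝒜 : Subalgebra ℂ (smoothFunctions ℝ))
    (A : FormalSymbol N) (Φ : 𝒜 →ₗ[ℂ] FormalSymbol N) : Prop where
  map_one : Φ 1 = 1
  map_mul : ∀ g h : 𝒜, Φ (g * h) = moyal (Φ g) (Φ h)
  map_coord : ∀ hmem : coordFn ∈ 𝒜, Φ ⟨coordFn, hmem⟩ = A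

/-- `f ∘ Re A₀` for a smooth `f : ℝ → ℂ`; it is used for real-valued `A₀` only, where it
is `f ∘ A₀`. -/
noncomputable def compClassical {N : ℕ} (f : smoothFunctions ℝ) (A₀ : ClassicalSymbol N) :
    ClassicalSymbol N :=
  ⟨fun z => (f : ℝ → ℂ) ((A₀ : PhaseSpace N → ℂ) z).re,
    ContDiff.comp (show ContDiff ℝ ∞ (f : ℝ → ℂ) from f.2)
      (Complex.reCLM.contDiff.comp (show ContDiff ℝ ∞ (A₀ : PhaseSpace N → ℂ) from A₀.2))⟩

/-- `f(A)`, the pointwise composition of `f` with `A = A₀ + ħ A₁ + ⋯`, expanded in `ħ` by Taylor's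
formula: `f(A) = ∑ⱼ f⁽ʲ⁾(A₀) (A - A₀)ʲ / j!`. As `A - A₀` is divisible by `ħ`, only the terms with
`j ≤ n` contribute to the coefficient of `ħⁿ`. -/
noncomputable def compSymbol {N : ℕ} (f : smoothFunctions ℝ) (A : FormalSymbol N) :
    FormalSymbol N :=
  PowerSeries.mk fun n => ∑ j ∈ Finset.range (n + 1),
    ((1 : ℂ) / (j.factorial : ℂ)) •
      (compClassical (derivFn^[j] f) (PowerSeries.constantCoeff A) *
        PowerSeries.coeff n ((A - PowerSeries.C (PowerSeries.constantCoeff A)) ^ j))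

/-! ### Graphs -/

/-- A labeled graph with `V` vertices and `E` edges: a map from the set of edges to the set of
two-element sets of vertices. -/
def LabeledGraph (V E : ℕ) : Type := Fin E → Set.powersetCard (Fin V) 2

/-- Permutations of the vertices and of the edges act on labeled graphs. -/
instance (V E : ℕ) :
    MulAction (Equiv.Perm (Fin V) × Equiv.Perm (Fin E)) (LabeledGraph V E) where
  smul g Γ := fun e => g.1 • Γ (g.2⁻¹ e)
  one_smul Γ := by
    funext e
    exact one_smul (Equiv.Perm (Fin V)) (Γ e)
  mul_smul g h Γ := by
    funext e
    change (g.1 * h.1) • Γ ((g.2 * h.2)⁻¹ e) = g.1 • h.1 • Γ (h.2⁻¹ (g.2⁻¹ e))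
    rw [mul_smul, mul_inv_rev, Equiv.Perm.mul_apply]

/-- An (unlabeled) graph is an orbit of labeled graphs. -/
abbrev UnlabeledGraph (V E : ℕ) : Type :=
  MulAction.orbitRel.Quotient (Equiv.Perm (Fin V) × Equiv.Perm (Fin E)) (LabeledGraph V E)

instance (V E : ℕ) : Finite (LabeledGraph V E) :=
  inferInstanceAs (Finite (Fin E → Set.powersetCard (Fin V) 2))

noncomputable instance (V E : ℕ) : Fintype (UnlabeledGraph V E) := Fintype.ofFinite _

namespace LabeledGraph

variable {V E : ℕ}

theorem edge_nonempty (Γ : LabeledGraph V E) (e : Fin E) : (Γ e : Finset (Fin V)).Nonempty := by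
  have h : (Γ e : Finset (Fin V)).card = 2 := (Γ e).2
  exact Finset.card_pos.mp (by omega)

/-- The source of an edge: its endpoint with the lower label. -/
def src (Γ : LabeledGraph V E) (e : Fin E) : Fin V :=
  (Γ e : Finset (Fin V)).min' (Γ.edge_nonempty e)

/-- The target of an edge: its endpoint with the higher label. -/
def tgt (Γ : LabeledGraph V E) (e : Fin E) : Fin V :=
  (Γ e : Finset (Fin V)).max' (Γ.edge_nonempty e)

/-- The order of symmetry `S_Γ`: the order of the stabilizer of `Γ` in `S_V × S_E`. -/
noncomputable def symOrder (Γ : LabeledGraph V E) : ℕ :=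
  Nat.card (MulAction.stabilizer (Equiv.Perm (Fin V) × Equiv.Perm (Fin E)) Γ)

/-- `c_Γ`: the sum over the `V!` reorderings `σ` of the vertices of `(-1)` to the number of edges
whose orientation (from the lower to the higher label) is inverted by `σ`. -/
def orderSum (Γ : LabeledGraph V E) : ℤ :=
  ∑ σ : Equiv.Perm (Fin V),
    (-1) ^ (Finset.univ.filter fun e : Fin E => σ (Γ.tgt e) < σ (Γ.src e)).card

/-- Every vertex lies on some edge. -/
def Reduced (Γ : LabeledGraph V E) : Prop :=
  ∀ v : Fin V, ∃ e : Fin E, v ∈ (Γ e : Finset (Fin V))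

/-- Adjacency of vertices, multiplicities forgotten. -/
def toSimpleGraph (Γ : LabeledGraph V E) : SimpleGraph (Fin V) where
  Adj u v := u ≠ v ∧ ∃ e : Fin E, u ∈ (Γ e : Finset (Fin V)) ∧ v ∈ (Γ e : Finset (Fin V))
  symm := ⟨fun _ _ h => ⟨h.1.symm, h.2.imp fun _ he => ⟨he.2, he.1⟩⟩⟩
  loopless := ⟨fun _ h => h.1 rfl⟩

/-- `Γ` is connected, reduced and non-empty. -/
def IsConnectedReduced (Γ : LabeledGraph V E) : Prop :=
  Γ.toSimpleGraph.Preconnected ∧ Γ.Reduced ∧ 0 < V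

/-- A reduced graph has at most twice as many vertices as edges. -/
theorem Reduced.card_le {Γ : LabeledGraph V E} (h : Γ.Reduced) : V ≤ 2 * E := by
  have hsub : (Finset.univ : Finset (Fin V)) ⊆
      Finset.univ.biUnion fun e : Fin E => (Γ e : Finset (Fin V)) := by
    intro v _
    obtain ⟨e, he⟩ := h v
    exact Finset.mem_biUnion.mpr ⟨e, Finset.mem_univ e, he⟩
  have h1 := Finset.card_le_card hsub
  have h2 : (Finset.univ.biUnion fun e : Fin E => (Γ e : Finset (Fin V))).card ≤
      (Finset.univ : Finset (Fin E)).card * 2 :=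
    Finset.card_biUnion_le_card_mul _ _ _ fun e _ => le_of_eq (Γ e).2
  simp only [Finset.card_univ, Fintype.card_fin] at h1 h2
  omega

/-- The indices of the derivatives that act on the symbol at the vertex `v`: an edge `e` that
starts at `v` contributes `μ e`, and an edge `e` that ends at `v` contributes `ν e`. -/
def indicesAt {N : ℕ} (Γ : LabeledGraph V E) (μ ν : Fin E → CoordIndex N) (v : Fin V) :
    List (CoordIndex N) :=
  (List.finRange E).filterMap fun e =>
    if Γ.src e = v then some (μ e) else if Γ.tgt e = v then some (ν e) else none

/-- `λ_Γ(C₁, …, C_V)`: every vertex `v` is replaced with `C_v`, and every edge with a Poisson tensor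
`J^{μν}` whose index `μ` differentiates at the source and `ν` at the target. -/
noncomputable def lam {N : ℕ} (Γ : LabeledGraph V E) (C : Fin V → FormalSymbol N) :
    FormalSymbol N :=
  ∑ μ : Fin E → CoordIndex N, ∑ ν : Fin E → CoordIndex N,
    (∏ e, poissonTensor N (μ e) (ν e)) • ∏ v, iterPderiv (Γ.indicesAt μ ν v) (C v)

end LabeledGraph

/-! ### The graph formula -/

/-- Formal power series in `ħ` whose coefficients are differential operators `∑ᵥ aᵥ Dᵛ`, with
`aᵥ` a smooth function on phase space and `D` (the variable of the polynomial ring) acting on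
functions of a real variable and commuting with the `aᵥ`. -/
abbrev FormalOperator (N : ℕ) : Type := PowerSeries (Polynomial (ClassicalSymbol N))

open Classical in
/-- The sum over connected, reduced, non-empty graphs `[Γ]` of
`(iħ/2)^E (c_Γ / S_Γ) λ_Γ(A) D^V / V!`. The function `rep` selects a representative of each graph.
For given `E`, a reduced graph has `V ≤ 2E`. -/
noncomputable def connectedGraphSum {N : ℕ}
    (rep : ∀ V E : ℕ, UnlabeledGraph V E → LabeledGraph V E) (A : FormalSymbol N) :
    FormalOperator N :=
  hbarSum fun E => ∑ V ∈ Finset.range (2 * E + 1), ∑ G : UnlabeledGraph V E,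
    if (rep V E G).IsConnectedReduced then
      ((Complex.I / 2) ^ E * (((rep V E G).orderSum : ℂ) / ((rep V E G).symOrder : ℂ)) /
          (V.factorial : ℂ)) •
        (PowerSeries.map Polynomial.C ((rep V E G).lam fun _ => A) *
          PowerSeries.C (Polynomial.X ^ V))
    else 0

/-- Non-empty reduced graphs have an edge, so that the sum over graphs is divisible by `ħ` and can be
substituted into a power series. -/
theorem constantCoeff_connectedGraphSum {N : ℕ}
    (rep : ∀ V E : ℕ, UnlabeledGraph V E → LabeledGraph V E) (A : FormalSymbol N) :
    PowerSeries.constantCoeff (connectedGraphSum rep A) = 0 := by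
  rw [← PowerSeries.coeff_zero_eq_constantCoeff_apply, connectedGraphSum, hbarSum,
    PowerSeries.coeff_mk]
  simp [LabeledGraph.IsConnectedReduced]

/-- The exponential `∑ₖ Pᵏ / k!` of a power series `P` in `ħ` with constant coefficient `0`. -/
noncomputable def expOperator {N : ℕ} (P : FormalOperator N) : FormalOperator N :=
  (PowerSeries.exp ℂ).subst P

/-- `P f(A)`: in `P = ∑ₙ ħⁿ ∑ᵥ a_{n,v} Dᵛ`, every `Dᵛ` is replaced with `f⁽ᵛ⁾(A)`. -/
noncomputable def applyOperator {N : ℕ} (P : FormalOperator N) (f : smoothFunctions ℝ)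
    (A : FormalSymbol N) : FormalSymbol N :=
  hbarSum fun n => (PowerSeries.coeff n P).sum fun v a =>
    PowerSeries.C a * compSymbol (derivFn^[v] f) A

/-! The formula is the exponential formula for connected graphs, applied to Moyal powers of `A` and
then extended from polynomials to `𝒜` by a comparison of jets.

Polynomials. In `(A ⋆ ⋯ ⋆ A) ⋆ A` the Leibniz rule makes every contraction join the new copy of `A`
to one of the earlier copies. Hence the `n`-th Moyal power is the operator `∏_{u<v} exp(ħ · edgeOp u
v)` applied to `n` ordered copies of `A` (`evalSeries_graphSeries`): a sum over all graphs with `n`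
vertices. Writing each exponential as `1 + (exp - 1)`, expanding, and sorting the sets of edges by
the connected component of one vertex gives `A^{⋆(n+1)} = ∑ₖ (n choose k) K_{k+1} A^{⋆(n-k)}`, with
`K_m` the sum over connected labeled graphs with `m` vertices (`moyalPow_succ_eq_sum`,
`evalSeries_connectedSeries`). So `Z(t) = ∑ₙ tⁿ A^{⋆n} / n!` solves the linear equation `Z' = (∑ₖ
K_{k+1} tᵏ / k!) Z`. The single vertex, which is not reduced, has `K_1 = A` and produces the factor
`exp(tA)`. The other connected graphs produce the exponential in the statement, with `t` in place of
`D`; orbit counting turns labeled sums into sums over `[Γ]` with weight `c_Γ / S_Γ`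
(`LabeledGraph.sum_unlabeledGraph_eq`). The coefficient of `tⁿ` is the claim for `f = yⁿ`
(`sum_opCoeff_expOperator`).

General `f`. Fix a point `z`, an order `ħⁿ`, and let `a = A₀(z)`. Repeated division gives `f =
polynomial + (y - a)^M h` within `𝒜`. For large `M` the remainder contributes nothing to the
right-hand side, which sees only a finite jet of `f` at `a`. On the left it becomes `(A - a)^{⋆M} ⋆
Φ(h)`, which vanishes to order `M` at `z` because `⋆` adds vanishing orders when `ħ` has weight two
(`VanishesAt.moyal`): each `ħ` in `⋆` costs one derivative on each factor. -/

/-! ### Formal sums in `ħ` -/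

section HbarSum

variable {R : Type} [Semiring R]

theorem coeff_hbarSum (F : ℕ → PowerSeries R) (n : ℕ) :
    PowerSeries.coeff n (hbarSum F) =
      ∑ p ∈ Finset.HasAntidiagonal.antidiagonal n, PowerSeries.coeff p.2 (F p.1) := by
  rw [hbarSum, PowerSeries.coeff_mk,
    Finset.Nat.sum_antidiagonal_eq_sum_range_succ (fun i j => PowerSeries.coeff j (F i))]

theorem hbarSum_congr {F G : ℕ → PowerSeries R} (h : ∀ k, F k = G k) : hbarSum F = hbarSum G := by
  rw [funext h]

theorem hbarSum_add (F G : ℕ → PowerSeries R) :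
    hbarSum (fun k => F k + G k) = hbarSum F + hbarSum G := by
  ext n
  simp [coeff_hbarSum, Finset.sum_add_distrib]

theorem hbarSum_zero : hbarSum (fun _ => (0 : PowerSeries R)) = 0 := by
  ext n
  simp [coeff_hbarSum]

theorem hbarSum_finset_sum {ι : Type*} (s : Finset ι) (F : ι → ℕ → PowerSeries R) :
    hbarSum (fun k => ∑ i ∈ s, F i k) = ∑ i ∈ s, hbarSum (F i) := by
  ext n
  simp only [coeff_hbarSum, map_sum]
  rw [Finset.sum_comm]

theorem hbarSum_smul {S : Type*} [Semiring S] [Module S R] (c : S) (F : ℕ → PowerSeries R) :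
    hbarSum (fun k => c • F k) = c • hbarSum F := by
  ext n
  simp [coeff_hbarSum, Finset.smul_sum]

theorem hbarSum_mul (F : ℕ → PowerSeries R) (G : PowerSeries R) :
    hbarSum F * G = hbarSum fun k => F k * G := by
  ext n
  rw [PowerSeries.coeff_mul, coeff_hbarSum]
  simp only [coeff_hbarSum, PowerSeries.coeff_mul, Finset.sum_mul]
  rw [Finset.sum_sigma', Finset.sum_sigma']
  -- Both sides run over triples of exponents with sum `n`; only the bracketing differs.
  refine Finset.sum_bij' (fun x _ => ⟨(x.2.1, x.2.2 + x.1.2), (x.2.2, x.1.2)⟩)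
    (fun x _ => ⟨(x.1.1 + x.2.1, x.2.2), (x.1.1, x.2.1)⟩) ?_ ?_ ?_ ?_ fun _ _ => rfl
  all_goals
    rintro ⟨⟨a, b⟩, ⟨c, d⟩⟩ h
    simp only [Finset.mem_sigma, Finset.HasAntidiagonal.mem_antidiagonal] at h ⊢
    obtain ⟨h1, h2⟩ := h
    subst h2
  · subst h1; simp [add_assoc]
  · subst h1; simp [add_assoc]
  · simp
  · simp

theorem hbarSum_hbarSum (F : ℕ → ℕ → PowerSeries R) :
    (hbarSum fun k => hbarSum (F k)) =
      hbarSum fun n => ∑ p ∈ Finset.HasAntidiagonal.antidiagonal n, F p.1 p.2 := by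
  ext n
  simp only [coeff_hbarSum, map_sum]
  rw [Finset.sum_sigma', Finset.sum_sigma']
  refine Finset.sum_bij' (fun x _ => ⟨(x.1.1 + x.2.1, x.2.2), (x.1.1, x.2.1)⟩)
    (fun x _ => ⟨(x.2.1, x.2.2 + x.1.2), (x.2.2, x.1.2)⟩) ?_ ?_ ?_ ?_ fun _ _ => rfl
  all_goals
    rintro ⟨⟨a, b⟩, ⟨c, d⟩⟩ h
    simp only [Finset.mem_sigma, Finset.HasAntidiagonal.mem_antidiagonal] at h ⊢
    obtain ⟨h1, h2⟩ := h
    subst h2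
  · subst h1; simp [add_assoc]
  · subst h1; simp [add_assoc]
  · simp
  · simp

end HbarSum

theorem mul_hbarSum {R : Type} [CommSemiring R] (F : ℕ → PowerSeries R) (G : PowerSeries R) :
    G * hbarSum F = hbarSum fun k => G * F k := by
  rw [mul_comm, hbarSum_mul]
  simp only [mul_comm]

theorem hbarSum_mul_hbarSum {R : Type} [CommSemiring R] (F G : ℕ → PowerSeries R) :
    hbarSum F * hbarSum G =
      hbarSum fun n => ∑ p ∈ Finset.HasAntidiagonal.antidiagonal n, F p.1 * G p.2 := by
  rw [hbarSum_mul, ← hbarSum_hbarSum fun k l => F k * G l]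
  simp only [mul_hbarSum]

/-- A formal sum with a single nonzero term, at the power zero of `ħ`. -/
theorem hbarSum_eq_zeroth {R : Type} [Semiring R] {F : ℕ → PowerSeries R}
    (h : ∀ k, k ≠ 0 → F k = 0) : hbarSum F = F 0 := by
  ext n
  rw [coeff_hbarSum, Finset.sum_eq_single (0, n)]
  · rintro ⟨a, b⟩ hab hne
    have : a ≠ 0 := by
      rintro rfl
      simp at hab
      exact hne (by rw [hab])
    simp [h a this]
  · simp

/-! ### Derivatives of symbols -/

section DirDeriv

variable {F : Type} [NormedAddCommGroup F] [NormedSpace ℝ F]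

theorem contDiff_coe (f : smoothFunctions F) : ContDiff ℝ ∞ (f : F → ℂ) := f.2

theorem differentiableAt_coe (f : smoothFunctions F) (z : F) :
    DifferentiableAt ℝ (f : F → ℂ) z :=
  ((contDiff_coe f).differentiable (by simp)) z

theorem dirDeriv_add (v : F) (f g : smoothFunctions F) :
    dirDeriv v (f + g) = dirDeriv v f + dirDeriv v g := by
  ext z
  change fderiv ℝ ((f : F → ℂ) + (g : F → ℂ)) z v = _
  rw [fderiv_add (differentiableAt_coe f z) (differentiableAt_coe g z)]
  rfl

theorem dirDeriv_smul (v : F) (c : ℂ) (f : smoothFunctions F) :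
    dirDeriv v (c • f) = c • dirDeriv v f := by
  ext z
  change fderiv ℝ (c • (f : F → ℂ)) z v = _
  rw [fderiv_const_smul (differentiableAt_coe f z)]
  rfl

/-- The directional derivative as a linear map. -/
noncomputable def dirDerivLM (v : F) : smoothFunctions F →ₗ[ℂ] smoothFunctions F where
  toFun := dirDeriv v
  map_add' := dirDeriv_add v
  map_smul' := dirDeriv_smul v

theorem dirDeriv_mul (v : F) (f g : smoothFunctions F) :
    dirDeriv v (f * g) = dirDeriv v f * g + f * dirDeriv v g := by
  ext z
  change fderiv ℝ ((f : F → ℂ) * (g : F → ℂ)) z v = _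
  rw [fderiv_mul (differentiableAt_coe f z) (differentiableAt_coe g z)]
  change (f : F → ℂ) z * fderiv ℝ (g : F → ℂ) z v + (g : F → ℂ) z * fderiv ℝ (f : F → ℂ) z v =
    fderiv ℝ (f : F → ℂ) z v * (g : F → ℂ) z + (f : F → ℂ) z * fderiv ℝ (g : F → ℂ) z v
  ring

/-- Symmetry of the second derivative. It allows iterated derivatives to be indexed by multisets. -/
theorem dirDeriv_comm (v w : F) (f : smoothFunctions F) :
    dirDeriv v (dirDeriv w f) = dirDeriv w (dirDeriv v f) := by
  ext z
  have hd : DifferentiableAt ℝ (fderiv ℝ (f : F → ℂ)) z :=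
    (((contDiff_coe f).fderiv_right (m := ∞) le_rfl).differentiable (by simp)) z
  have key : ∀ a b : F, (dirDeriv a (dirDeriv b f) : F → ℂ) z =
      fderiv ℝ (fderiv ℝ (f : F → ℂ)) z a b := by
    intro a b
    change fderiv ℝ (fun y => fderiv ℝ (f : F → ℂ) y b) z a = _
    rw [fderiv_clm_apply hd (differentiableAt_const b)]
    simp
  rw [key, key]
  have hs : IsSymmSndFDerivAt ℝ (f : F → ℂ) z :=
    (contDiff_coe f).contDiffAt.isSymmSndFDerivAt (by simpa using WithTop.coe_le_coe.mpr (le_top : (2 : ℕ∞) ≤ ⊤))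
  exact hs v w

end DirDeriv

section Symbols

variable {N : ℕ}

theorem coeff_pderivSymbol (μ : CoordIndex N) (C : FormalSymbol N) (n : ℕ) :
    PowerSeries.coeff n (pderivSymbol μ C) =
      dirDerivLM (Pi.single μ (1 : ℝ)) (PowerSeries.coeff n C) := by
  rw [pderivSymbol, PowerSeries.coeff_mk]
  rfl

theorem pderivSymbol_comm (μ ν : CoordIndex N) (C : FormalSymbol N) :
    pderivSymbol μ (pderivSymbol ν C) = pderivSymbol ν (pderivSymbol μ C) := by
  ext1 n
  simp only [coeff_pderivSymbol]
  exact dirDeriv_comm _ _ _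

/-- `∂_μ` as a derivation of the algebra of symbols. -/
noncomputable def pderivD (μ : CoordIndex N) : Derivation ℂ (FormalSymbol N) (FormalSymbol N) :=
  Derivation.mk'
    { toFun := pderivSymbol μ
      map_add' := fun C D => by
        ext1 n
        simp only [coeff_pderivSymbol, map_add]
      map_smul' := fun c C => by
        ext1 n
        simp only [coeff_pderivSymbol, PowerSeries.coeff_smul, map_smul, RingHom.id_apply] }
    (fun C D => by
      ext1 n
      change PowerSeries.coeff n (pderivSymbol μ (C * D)) =
        PowerSeries.coeff n (C • pderivSymbol μ D + D • pderivSymbol μ C)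
      simp only [coeff_pderivSymbol, PowerSeries.coeff_mul, map_sum, map_add, smul_eq_mul]
      -- The Leibniz rule of `Derivation` puts `D` first in its second term, so that sum has to be
      -- flipped before the terms match.
      rw [← Finset.Nat.sum_antidiagonal_swap (n := n)
        (f := fun p => PowerSeries.coeff p.1 D * _), ← Finset.sum_add_distrib]
      refine Finset.sum_congr rfl fun p _ => ?_
      rw [Prod.fst_swap, Prod.snd_swap]
      refine (dirDeriv_mul _ _ _).trans ?_
      rw [add_comm, mul_comm (dirDeriv _ _)]
      rfl)

theorem pderivD_apply (μ : CoordIndex N) (C : FormalSymbol N) : pderivD μ C = pderivSymbol μ C :=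
  rfl

theorem pderivSymbol_hbarSum (μ : CoordIndex N) (F : ℕ → FormalSymbol N) :
    pderivSymbol μ (hbarSum F) = hbarSum fun k => pderivSymbol μ (F k) := by
  ext1 n
  simp only [coeff_hbarSum, coeff_pderivSymbol, map_sum]

instance : LeftCommutative (pderivSymbol (N := N)) := ⟨pderivSymbol_comm⟩

/-- The partial derivative of a symbol indexed by a multiset of coordinates. -/
noncomputable def multiDeriv (s : Multiset (CoordIndex N)) (C : FormalSymbol N) : FormalSymbol N :=
  s.foldr pderivSymbol C

theorem iterPderiv_eq_multiDeriv (l : List (CoordIndex N)) (C : FormalSymbol N) :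
    iterPderiv l C = multiDeriv (l : Multiset (CoordIndex N)) C := rfl

theorem multiDeriv_zero (C : FormalSymbol N) : multiDeriv 0 C = C := rfl

theorem pderivSymbol_multiDeriv (μ : CoordIndex N) (s : Multiset (CoordIndex N))
    (C : FormalSymbol N) : pderivSymbol μ (multiDeriv s C) = multiDeriv ({μ} + s) C := by
  rw [multiDeriv, multiDeriv, Multiset.singleton_add, Multiset.foldr_cons]

theorem iterPderiv_cons (μ : CoordIndex N) (l : List (CoordIndex N)) (C : FormalSymbol N) :
    iterPderiv (μ :: l) C = pderivSymbol μ (iterPderiv l C) := rfl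

theorem iterPderiv_nil (C : FormalSymbol N) : iterPderiv [] C = C := rfl

theorem iterPderiv_append (l l' : List (CoordIndex N)) (C : FormalSymbol N) :
    iterPderiv (l ++ l') C = iterPderiv l (iterPderiv l' C) := by
  simp [iterPderiv, List.foldr_append]

theorem iterPderiv_hbarSum (l : List (CoordIndex N)) (F : ℕ → FormalSymbol N) :
    iterPderiv l (hbarSum F) = hbarSum fun k => iterPderiv l (F k) := by
  induction l with
  | nil => rfl
  | cons μ l ih => simp only [iterPderiv_cons, ih, pderivSymbol_hbarSum]

/-- The iterated partial derivative as a linear map. -/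
noncomputable def iterPderivLM (l : List (CoordIndex N)) : FormalSymbol N →ₗ[ℂ] FormalSymbol N :=
  l.foldr (fun μ T => (pderivD μ).toLinearMap ∘ₗ T) LinearMap.id

theorem iterPderivLM_apply (l : List (CoordIndex N)) (C : FormalSymbol N) :
    iterPderivLM l C = iterPderiv l C := by
  induction l with
  | nil => rfl
  | cons μ l ih => exact congrArg (pderivSymbol μ) ih

theorem pderivSymbol_iterPderiv (μ : CoordIndex N) (l : List (CoordIndex N))
    (C : FormalSymbol N) : pderivSymbol μ (iterPderiv l C) = iterPderiv l (pderivSymbol μ C) := by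
  induction l with
  | nil => rfl
  | cons ν l ih => rw [iterPderiv_cons, pderivSymbol_comm, ih, iterPderiv_cons]

end Symbols

/-! ### The exponential series `∑ₖ ħᵏ xᵏ / k!` -/

section ExpSeries

variable {R : Type} [CommRing R] [Algebra ℂ R]

/-- The exponential `exp (ħ x)`. -/
noncomputable def expSeries (x : R) : PowerSeries R :=
  PowerSeries.mk fun k => (1 / (k.factorial : ℂ)) • x ^ k

theorem coeff_expSeries (x : R) (k : ℕ) :
    PowerSeries.coeff k (expSeries x) = (1 / (k.factorial : ℂ)) • x ^ k :=
  PowerSeries.coeff_mk _ _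

theorem expSeries_zero : expSeries (0 : R) = 1 := by
  ext k
  rw [coeff_expSeries, PowerSeries.coeff_one]
  split_ifs with h
  · simp [h]
  · simp [h]

theorem expSeries_add (x y : R) : expSeries (x + y) = expSeries x * expSeries y := by
  ext n
  rw [coeff_expSeries, PowerSeries.coeff_mul, (Commute.all x y).add_pow', Finset.smul_sum]
  refine Finset.sum_congr rfl fun p hp => ?_
  rw [coeff_expSeries, coeff_expSeries, smul_mul_smul_comm, ← Nat.cast_smul_eq_nsmul ℂ, smul_smul]
  congr 1
  rw [Finset.HasAntidiagonal.mem_antidiagonal] at hp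
  subst hp
  have h := Nat.add_choose_mul_factorial_mul_factorial p.1 p.2
  rw [← Nat.choose_symm_add] at h
  have h1 : (p.1.factorial : ℂ) ≠ 0 := Nat.cast_ne_zero.mpr (Nat.factorial_ne_zero _)
  have h2 : (p.2.factorial : ℂ) ≠ 0 := Nat.cast_ne_zero.mpr (Nat.factorial_ne_zero _)
  have h3 : ((p.1 + p.2).factorial : ℂ) ≠ 0 := Nat.cast_ne_zero.mpr (Nat.factorial_ne_zero _)
  field_simp
  exact_mod_cast h

theorem expSeries_sum {ι : Type*} (s : Finset ι) (x : ι → R) :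
    expSeries (∑ i ∈ s, x i) = ∏ i ∈ s, expSeries (x i) := by
  classical
  induction s using Finset.induction_on with
  | empty => simp [expSeries_zero]
  | insert a s ha ih => rw [Finset.sum_insert ha, Finset.prod_insert ha, expSeries_add, ih]

end ExpSeries

/-! ### The algebra of multidifferential operators -/

theorem prod_sum_sum {R ι κ : Type*} [CommSemiring R] [Fintype ι] [DecidableEq ι] [Fintype κ]
    (a : ι → κ → κ → R) :
    ∏ i, ∑ μ, ∑ ν, a i μ ν = ∑ μ : ι → κ, ∑ ν : ι → κ, ∏ i, a i (μ i) (ν i) := by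
  rw [Finset.prod_univ_sum, Fintype.piFinset_univ]
  refine Finset.sum_congr rfl fun μ _ => ?_
  rw [Finset.prod_univ_sum, Fintype.piFinset_univ]

/-- Polynomials in commuting derivatives `∂_μ` acting on the symbols placed at the vertices
labeled by the natural numbers. A monomial is the family of the indices at each vertex. -/
abbrev VertexAlgebra (N : ℕ) : Type := AddMonoidAlgebra ℂ (ℕ → Multiset (CoordIndex N))

section Evaluation

variable {N : ℕ}

/-- The derivative `∂_μ` at the vertex `u`. -/
noncomputable def vertexDeriv (u : ℕ) (μ : CoordIndex N) : VertexAlgebra N :=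
  AddMonoidAlgebra.single (Pi.single u {μ}) 1

/-- A multidifferential operator applied to copies of `A` at the vertices in `S`. -/
noncomputable def evalAt (A : FormalSymbol N) (S : Finset ℕ) :
    VertexAlgebra N →ₗ[ℂ] FormalSymbol N :=
  (Finsupp.linearCombination ℂ fun m : ℕ → Multiset (CoordIndex N) =>
    ∏ v ∈ S, multiDeriv (m v) A) ∘ₗ (AddMonoidAlgebra.coeffLinearEquiv ℂ).toLinearMap

theorem evalAt_single (A : FormalSymbol N) (S : Finset ℕ) (m : ℕ → Multiset (CoordIndex N))
    (c : ℂ) :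
    evalAt A S (AddMonoidAlgebra.single m c) = c • ∏ v ∈ S, multiDeriv (m v) A := by
  change Finsupp.linearCombination ℂ _ (Finsupp.single m c) = _
  rw [Finsupp.linearCombination_single]

theorem evalAt_one (A : FormalSymbol N) (S : Finset ℕ) : evalAt A S 1 = A ^ S.card := by
  rw [AddMonoidAlgebra.one_def, evalAt_single, one_smul]
  simp [multiDeriv_zero]

/-- The operators that act on the vertices in `S` only. -/
noncomputable def supportedOn (N : ℕ) (S : Finset ℕ) : Subalgebra ℂ (VertexAlgebra N) :=
  (Submodule.span ℂ ((fun m => AddMonoidAlgebra.single m (1 : ℂ)) ''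
    {m : ℕ → Multiset (CoordIndex N) | ∀ v ∉ S, m v = 0})).toSubalgebra
    (Submodule.subset_span ⟨0, fun _ _ => rfl, rfl⟩)
    (fun x y hx hy => by
      have h := Submodule.mul_mem_mul hx hy
      rw [Submodule.span_mul_span] at h
      refine Submodule.span_mono ?_ h
      rintro _ ⟨_, ⟨m, hm, rfl⟩, _, ⟨m', hm', rfl⟩, rfl⟩
      refine ⟨m + m', fun v hv => ?_, ?_⟩
      · rw [Pi.add_apply, hm v hv, hm' v hv, add_zero]
      · simp [AddMonoidAlgebra.single_mul_single])

theorem single_mem_supportedOn {S : Finset ℕ} {m : ℕ → Multiset (CoordIndex N)}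
    (hm : ∀ v ∉ S, m v = 0) : AddMonoidAlgebra.single m (1 : ℂ) ∈ supportedOn N S :=
  Submodule.subset_span ⟨m, hm, rfl⟩

theorem vertexDeriv_mem {S : Finset ℕ} {u : ℕ} (hu : u ∈ S) (μ : CoordIndex N) :
    vertexDeriv u μ ∈ supportedOn N S :=
  single_mem_supportedOn fun v hv => Pi.single_eq_of_ne (by rintro rfl; exact hv hu) _

/-- Operators on disjoint sets of vertices do not interact: `q` adds no derivative at a vertex of
`S`, nor `p` at one of `S'`. This makes disconnected graphs factorize. -/
theorem evalAt_mul (A : FormalSymbol N) {S S' : Finset ℕ} (hd : Disjoint S S')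
    {p q : VertexAlgebra N} (hp : p ∈ supportedOn N S) (hq : q ∈ supportedOn N S') :
    evalAt A (S ∪ S') (p * q) = evalAt A S p * evalAt A S' q := by
  change p ∈ Submodule.span ℂ _ at hp
  change q ∈ Submodule.span ℂ _ at hq
  induction hp, hq using Submodule.span_induction₂ with
  | mem_mem x y hx hy =>
    obtain ⟨m, hm, rfl⟩ := hx
    obtain ⟨m', hm', rfl⟩ := hy
    simp only [AddMonoidAlgebra.single_mul_single, evalAt_single, mul_one, one_smul]
    rw [Finset.prod_union hd]
    congr 1
    · refine Finset.prod_congr rfl fun v hv => ?_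
      rw [Pi.add_apply, hm' v (Finset.disjoint_left.mp hd hv), add_zero]
    · refine Finset.prod_congr rfl fun v hv => ?_
      rw [Pi.add_apply, hm v (Finset.disjoint_right.mp hd hv), zero_add]
  | zero_left y _ => simp
  | zero_right x _ => simp
  | add_left x y z _ _ _ h1 h2 => rw [add_mul, map_add, h1, h2, map_add, add_mul]
  | add_right x y z _ _ _ h1 h2 => rw [mul_add, map_add, h1, h2, map_add, mul_add]
  | smul_left r x y _ _ h => rw [smul_mul_assoc, map_smul, h, map_smul, smul_mul_assoc]
  | smul_right r x y _ _ h => rw [mul_smul_comm, map_smul, h, map_smul, mul_smul_comm]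

/-- The Leibniz rule. -/
theorem pderivSymbol_evalAt (A : FormalSymbol N) (S : Finset ℕ) (μ : CoordIndex N)
    (p : VertexAlgebra N) :
    pderivSymbol μ (evalAt A S p) = evalAt A S (p * ∑ u ∈ S, vertexDeriv u μ) := by
  rw [← pderivD_apply]
  induction p using AddMonoidAlgebra.induction_linear with
  | zero => simp
  | add p q hp hq => rw [map_add, map_add, hp, hq, add_mul, map_add]
  | single m c =>
    rw [evalAt_single, Derivation.map_smul, Finset.mul_sum, map_sum]
    simp only [vertexDeriv, AddMonoidAlgebra.single_mul_single, evalAt_single, mul_one]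
    rw [← Finset.smul_sum]
    congr 1
    -- Differentiating the factor at `u` adds `μ` to the multiset at `u`, which is multiplication by
    -- `vertexDeriv u μ`.
    induction S using Finset.induction_on with
    | empty => simp
    | insert a S ha ih =>
      rw [Finset.prod_insert ha, Derivation.leibniz, ih, Finset.sum_insert ha, Finset.prod_insert ha,
        add_comm, smul_eq_mul, smul_eq_mul, Finset.mul_sum]
      congr 1
      · rw [mul_comm, Pi.add_apply, Pi.single_eq_same, pderivD_apply, pderivSymbol_multiDeriv,
          add_comm (m a)]
        congr 1
        refine Finset.prod_congr rfl fun v hv => ?_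
        rw [Pi.add_apply, Pi.single_eq_of_ne (by rintro rfl; exact ha hv), add_zero]
      · refine Finset.sum_congr rfl fun u hu => ?_
        rw [Finset.prod_insert ha, Pi.add_apply,
          Pi.single_eq_of_ne (by rintro rfl; exact ha hu), add_zero]

theorem iterPderiv_evalAt (A : FormalSymbol N) (S : Finset ℕ) (l : List (CoordIndex N))
    (p : VertexAlgebra N) :
    iterPderiv l (evalAt A S p) =
      evalAt A S (p * (l.map fun μ => ∑ u ∈ S, vertexDeriv u μ).prod) := by
  induction l with
  | nil => simp [iterPderiv_nil]
  | cons μ l ih =>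
    rw [iterPderiv_cons, ih, pderivSymbol_evalAt, List.map_cons, List.prod_cons]
    congr 1
    ring

/-- The operator `(i/2) J^{μν} ∂_μ ∂_ν` of an edge from `u` to `v`. -/
noncomputable def edgeOp (N u v : ℕ) : VertexAlgebra N :=
  (Complex.I / 2) • ∑ μ, ∑ ν, poissonTensor N μ ν • (vertexDeriv u μ * vertexDeriv v ν)

theorem edgeOp_mem {S : Finset ℕ} {u v : ℕ} (hu : u ∈ S) (hv : v ∈ S) :
    edgeOp N u v ∈ supportedOn N S :=
  Subalgebra.smul_mem _ (Subalgebra.sum_mem _ fun μ _ => Subalgebra.sum_mem _ fun ν _ =>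
    Subalgebra.smul_mem _ (Subalgebra.mul_mem _ (vertexDeriv_mem hu μ) (vertexDeriv_mem hv ν)) _) _

theorem poissonTensor_antisymm (μ ν : CoordIndex N) :
    poissonTensor N ν μ = -poissonTensor N μ ν := by
  rcases μ with i | i <;> rcases ν with j | j <;>
    simp [poissonTensor, Matrix.one_apply, eq_comm]

/-- The antisymmetry of the Poisson tensor is the source of the signs in `c_Γ`. -/
theorem edgeOp_swap (u v : ℕ) : edgeOp N v u = -edgeOp N u v := by
  rw [edgeOp, edgeOp, Finset.sum_comm, ← smul_neg, ← Finset.sum_neg_distrib]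
  congr 1
  refine Finset.sum_congr rfl fun μ _ => ?_
  rw [← Finset.sum_neg_distrib]
  refine Finset.sum_congr rfl fun ν _ => ?_
  rw [poissonTensor_antisymm, neg_smul, mul_comm]

theorem multiDeriv_eq_evalAt (A : FormalSymbol N) (n : ℕ) {k : ℕ} (ν : Fin k → CoordIndex N) :
    iterPderiv (List.ofFn ν) A = evalAt A {n} (∏ i, vertexDeriv n (ν i)) := by
  have h : A = evalAt A {n} 1 := by simp [evalAt_one]
  conv_lhs => rw [h]
  rw [iterPderiv_evalAt, one_mul, List.map_ofFn, List.prod_ofFn]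
  simp

/-- By the Leibniz rule a derivative of the left factor is a sum over the vertices in `S` that it
can hit. Each of the `k` contractions thus becomes the sum of all edges from `S` to the new vertex
`n`. -/
theorem moyalBracket_evalAt (A : FormalSymbol N) {S : Finset ℕ} {n : ℕ} (hn : n ∉ S)
    {p : VertexAlgebra N} (hp : p ∈ supportedOn N S) (k : ℕ) :
    (Complex.I / 2) ^ k • moyalBracket k (evalAt A S p) A =
      evalAt A (insert n S) (p * (∑ u ∈ S, edgeOp N u n) ^ k) := by
  have hd : Disjoint S {n} := Finset.disjoint_singleton_right.mpr hn
  have h1 : ∑ u ∈ S, edgeOp N u n = (Complex.I / 2) • ∑ μ, ∑ ν,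
      poissonTensor N μ ν • ((∑ u ∈ S, vertexDeriv u μ) * vertexDeriv n ν) := by
    simp only [edgeOp, ← Finset.smul_sum]
    rw [Finset.sum_comm]
    congr 1
    refine Finset.sum_congr rfl fun μ _ => ?_
    rw [Finset.sum_comm]
    refine Finset.sum_congr rfl fun ν _ => ?_
    rw [Finset.sum_mul, Finset.smul_sum]
  rw [h1, smul_pow, mul_smul_comm, map_smul]
  congr 1
  rw [← Fin.prod_const, prod_sum_sum, Finset.mul_sum, map_sum, moyalBracket]
  refine Finset.sum_congr rfl fun μ _ => ?_
  rw [Finset.mul_sum, map_sum]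
  refine Finset.sum_congr rfl fun ν _ => ?_
  have h2 : (∏ i, poissonTensor N (μ i) (ν i) •
      ((∑ u ∈ S, vertexDeriv u (μ i)) * vertexDeriv n (ν i))) =
      (∏ i, poissonTensor N (μ i) (ν i)) •
        ((∏ i, ∑ u ∈ S, vertexDeriv u (μ i)) * ∏ i, vertexDeriv n (ν i)) := by
    rw [Finset.prod_smul, Finset.prod_mul_distrib]
  rw [h2, mul_smul_comm, map_smul, ← mul_assoc, Finset.insert_eq, Finset.union_comm,
    evalAt_mul A hd, iterPderiv_evalAt, ← multiDeriv_eq_evalAt, List.map_ofFn, List.prod_ofFn]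
  · rfl
  · exact Subalgebra.mul_mem _ hp (Subalgebra.prod_mem _ fun i _ =>
      Subalgebra.sum_mem _ fun u hu => vertexDeriv_mem hu _)
  · exact Subalgebra.prod_mem _ fun i _ => vertexDeriv_mem (Finset.mem_singleton_self n) _

end Evaluation

/-! ### Moyal powers as sums over all graphs -/

section EvalSeries

variable {N : ℕ}

/-- The operators `∑ₖ ħᵏ Pₖ` applied to copies of `A` at the vertices in `S`. -/
noncomputable def evalSeries (A : FormalSymbol N) (S : Finset ℕ) :
    PowerSeries (VertexAlgebra N) →ₗ[ℂ] FormalSymbol N where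
  toFun P := hbarSum fun k => evalAt A S (PowerSeries.coeff k P)
  map_add' P Q := by simp only [map_add, hbarSum_add]
  map_smul' c P := by
    simp only [PowerSeries.coeff_smul, map_smul, hbarSum_smul, RingHom.id_apply]

theorem evalSeries_apply (A : FormalSymbol N) (S : Finset ℕ) (P : PowerSeries (VertexAlgebra N)) :
    evalSeries A S P = hbarSum fun k => evalAt A S (PowerSeries.coeff k P) := rfl

theorem evalSeries_one (A : FormalSymbol N) (S : Finset ℕ) : evalSeries A S 1 = A ^ S.card := by
  rw [evalSeries_apply, hbarSum_eq_zeroth, PowerSeries.coeff_zero_eq_constantCoeff, map_one,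
    evalAt_one]
  intro k hk
  rw [PowerSeries.coeff_one, if_neg hk, map_zero]

/-- The series of operators that act on the vertices in `S` only. -/
noncomputable def supportedSeries (N : ℕ) (S : Finset ℕ) :
    Subalgebra ℂ (PowerSeries (VertexAlgebra N)) where
  carrier := {P | ∀ k, PowerSeries.coeff k P ∈ supportedOn N S}
  mul_mem' hP hQ k := by
    rw [PowerSeries.coeff_mul]
    exact Subalgebra.sum_mem _ fun i _ => Subalgebra.mul_mem _ (hP _) (hQ _)
  add_mem' hP hQ k := by
    rw [map_add]
    exact Subalgebra.add_mem _ (hP k) (hQ k)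
  algebraMap_mem' c k := by
    rw [Algebra.algebraMap_eq_smul_one, PowerSeries.coeff_smul, PowerSeries.coeff_one]
    refine Subalgebra.smul_mem _ ?_ _
    split_ifs
    · exact Subalgebra.one_mem _
    · exact Subalgebra.zero_mem _

theorem expSeries_mem {S : Finset ℕ} {x : VertexAlgebra N} (hx : x ∈ supportedOn N S) :
    expSeries x ∈ supportedSeries N S := fun k => by
  rw [coeff_expSeries]
  exact Subalgebra.smul_mem _ (Subalgebra.pow_mem _ hx k) _

theorem evalSeries_mul (A : FormalSymbol N) {S S' : Finset ℕ} (hd : Disjoint S S')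
    {P Q : PowerSeries (VertexAlgebra N)} (hP : P ∈ supportedSeries N S)
    (hQ : Q ∈ supportedSeries N S') :
    evalSeries A (S ∪ S') (P * Q) = evalSeries A S P * evalSeries A S' Q := by
  rw [evalSeries_apply, evalSeries_apply, evalSeries_apply, hbarSum_mul_hbarSum]
  refine hbarSum_congr fun k => ?_
  rw [PowerSeries.coeff_mul, map_sum]
  exact Finset.sum_congr rfl fun p _ => evalAt_mul A hd (hP _) (hQ _)

theorem moyalBracket_hbarSum_left (k : ℕ) (F : ℕ → FormalSymbol N) (D : FormalSymbol N) :
    moyalBracket k (hbarSum F) D = hbarSum fun E => moyalBracket k (F E) D := by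
  simp only [moyalBracket, iterPderiv_hbarSum, hbarSum_mul, ← hbarSum_smul,
    ← hbarSum_finset_sum]

/-- The factors `1/k!` of the Moyal product assemble the `k`-th powers of the sum of new edges into
an exponential. -/
theorem moyal_evalSeries (A : FormalSymbol N) {S : Finset ℕ} {n : ℕ} (hn : n ∉ S)
    {P : PowerSeries (VertexAlgebra N)} (hP : P ∈ supportedSeries N S) :
    moyal (evalSeries A S P) A =
      evalSeries A (insert n S) (P * expSeries (∑ u ∈ S, edgeOp N u n)) := by
  rw [moyal, evalSeries_apply, evalSeries_apply]
  simp only [moyalBracket_hbarSum_left, ← hbarSum_smul]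
  rw [hbarSum_hbarSum]
  refine hbarSum_congr fun n => ?_
  rw [mul_comm P, PowerSeries.coeff_mul, map_sum]
  refine Finset.sum_congr rfl fun p _ => ?_
  rw [coeff_expSeries, smul_mul_assoc, map_smul, mul_comm, ← moyalBracket_evalAt A hn (hP _),
    smul_smul, div_eq_mul_one_div, mul_comm]

/-- The ordered pairs of vertices in `S`. -/
def edgesOn (S : Finset ℕ) : Finset (ℕ × ℕ) := (S ×ˢ S).filter fun e => e.1 < e.2

theorem mem_edgesOn {S : Finset ℕ} {e : ℕ × ℕ} :
    e ∈ edgesOn S ↔ (e.1 ∈ S ∧ e.2 ∈ S) ∧ e.1 < e.2 := by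
  simp [edgesOn]

theorem edgesOn_insert {S : Finset ℕ} {n : ℕ} (h : ∀ u ∈ S, u < n) :
    edgesOn (insert n S) = edgesOn S ∪ S.image fun u => (u, n) := by
  ext ⟨u, v⟩
  simp only [mem_edgesOn, Finset.mem_insert, Finset.mem_union, Finset.mem_image, Prod.mk.injEq]
  constructor
  · rintro ⟨⟨rfl | hu, rfl | hv⟩, hlt⟩
    · exact absurd hlt (lt_irrefl _)
    · exact absurd (h v hv) (not_lt.mpr hlt.le)
    · exact Or.inr ⟨u, hu, rfl, rfl⟩
    · exact Or.inl ⟨⟨hu, hv⟩, hlt⟩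
  · rintro (⟨⟨hu, hv⟩, hlt⟩ | ⟨w, hw, rfl, rfl⟩)
    · exact ⟨⟨Or.inr hu, Or.inr hv⟩, hlt⟩
    · exact ⟨⟨Or.inr hw, Or.inl rfl⟩, h w hw⟩

/-- The sum over all graphs on the vertices in `S` of their operators, that is, the operator
whose value on copies of `A` is the Moyal power of `A`. -/
noncomputable def graphSeries (N : ℕ) (S : Finset ℕ) : PowerSeries (VertexAlgebra N) :=
  expSeries (∑ e ∈ edgesOn S, edgeOp N e.1 e.2)

theorem graphSeries_mem (S : Finset ℕ) : graphSeries N S ∈ supportedSeries N S :=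
  expSeries_mem (Subalgebra.sum_mem _ fun _ he =>
    edgeOp_mem (mem_edgesOn.mp he).1.1 (mem_edgesOn.mp he).1.2)

theorem graphSeries_insert {S : Finset ℕ} {n : ℕ} (h : ∀ u ∈ S, u < n) :
    graphSeries N (insert n S) = graphSeries N S * expSeries (∑ u ∈ S, edgeOp N u n) := by
  rw [graphSeries, graphSeries, ← expSeries_add, edgesOn_insert h, Finset.sum_union,
    Finset.sum_image]
  · intro a _ b _ hab
    exact (Prod.mk.injEq _ _ _ _ ▸ hab).1
  · rw [Finset.disjoint_left]
    rintro ⟨u, v⟩ he he'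
    obtain ⟨w, _, hw⟩ := Finset.mem_image.mp he'
    obtain ⟨rfl, rfl⟩ := Prod.mk.inj hw
    exact lt_irrefl _ (h _ (mem_edgesOn.mp he).1.2)

/-- The Moyal power `A ⋆ ⋯ ⋆ A`. -/
noncomputable def moyalPow (A : FormalSymbol N) : ℕ → FormalSymbol N
  | 0 => 1
  | n + 1 => moyal (moyalPow A n) A

/-- Vertices are added in increasing order, so the new factor `A` stands to the right of all others
and every new edge points to it. Hence edges run from lower to higher labels, and the value depends
on `S` only through its cardinality. -/
theorem evalSeries_graphSeries (A : FormalSymbol N) (S : Finset ℕ) :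
    evalSeries A S (graphSeries N S) = moyalPow A S.card := by
  induction S using Finset.induction_on_max with
  | empty =>
    have : graphSeries N ∅ = 1 := by simp [graphSeries, edgesOn, expSeries_zero]
    rw [this, evalSeries_one]
    simp [moyalPow]
  | insert n S hn ih =>
    have hn' : n ∉ S := fun h => lt_irrefl _ (hn n h)
    rw [graphSeries_insert hn, ← moyal_evalSeries A hn' (graphSeries_mem S), ih,
      Finset.card_insert_of_notMem hn', moyalPow]

end EvalSeries

/-! ### Sums over sets of edges -/

section MayerExpansion

variable {R ι : Type} [CommRing R] [Algebra ℂ R] [DecidableEq ι]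

/-- The weight `∏ (exp (ħ xₑ) - 1)` of a set of edges. -/
noncomputable def edgeSetWeight (x : ι → R) (H : Finset ι) : PowerSeries R :=
  ∏ e ∈ H, (expSeries (x e) - 1)

/-- The exponential generating function of the sequences of edges with image `H`. -/
noncomputable def surjSeries (x : ι → R) (H : Finset ι) : PowerSeries R :=
  PowerSeries.mk fun E => (1 / (E.factorial : ℂ)) •
    ∑ γ ∈ (Fintype.piFinset fun _ : Fin E => H) with Finset.univ.image γ = H, ∏ i, x (γ i)

/-- Mayer's trick: write each factor `exp(ħ xₑ)` as `1 + (exp(ħ xₑ) - 1)` and expand the product.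
Connectivity can then be read off from the set `H'` of edges present. -/
theorem expSeries_sum_eq_sum_edgeSetWeight (x : ι → R) (H : Finset ι) :
    expSeries (∑ e ∈ H, x e) = ∑ H' ∈ H.powerset, edgeSetWeight x H' := by
  rw [expSeries_sum]
  simp only [edgeSetWeight]
  rw [← Finset.prod_add_one]
  simp

/-- Sequences of edges are grouped by their image, so a condition on the underlying set of edges can
be imposed on either side. -/
theorem sum_surjSeries_filter (x : ι → R) (H : Finset ι) (P : Finset ι → Prop)
    [DecidablePred P] :
    ∑ H' ∈ H.powerset with P H', surjSeries x H' =
      PowerSeries.mk fun E => (1 / (E.factorial : ℂ)) •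
        ∑ γ ∈ (Fintype.piFinset fun _ : Fin E => H) with P (Finset.univ.image γ),
          ∏ i, x (γ i) := by
  ext E
  rw [map_sum, PowerSeries.coeff_mk]
  simp only [surjSeries, PowerSeries.coeff_mk]
  rw [← Finset.smul_sum]
  congr 1
  have hmaps : ∀ γ ∈ (Fintype.piFinset fun _ : Fin E => H).filter
      (fun γ => P (Finset.univ.image γ)),
      Finset.univ.image γ ∈ H.powerset.filter P := by
    intro γ hγ
    rw [Finset.mem_filter, Fintype.mem_piFinset] at hγ
    refine Finset.mem_filter.mpr ⟨Finset.mem_powerset.mpr ?_, hγ.2⟩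
    exact Finset.image_subset_iff.mpr fun i _ => hγ.1 i
  rw [← Finset.sum_fiberwise_of_maps_to hmaps]
  refine Finset.sum_congr rfl fun H' hH' => Finset.sum_congr ?_ fun _ _ => rfl
  rw [Finset.mem_filter, Finset.mem_powerset] at hH'
  ext γ
  simp only [Finset.mem_filter, Fintype.mem_piFinset]
  constructor
  · rintro ⟨h1, h2⟩
    exact ⟨⟨fun i => hH'.1 (h1 i), h2 ▸ hH'.2⟩, h2⟩
  · rintro ⟨_, h2⟩
    exact ⟨fun i => h2 ▸ Finset.mem_image_of_mem γ (Finset.mem_univ i), h2⟩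

/-- Summed over all subsets of `H`, both sides give `exp(ħ ∑ xₑ)`: sequences without restriction on
one side, Mayer's expansion on the other. Strong induction cancels the proper subsets and leaves the
term of `H`. -/
theorem surjSeries_eq (x : ι → R) (H : Finset ι) : surjSeries x H = edgeSetWeight x H := by
  induction H using Finset.strongInduction with
  | H H ih =>
    have h : ∑ H' ∈ H.powerset, surjSeries x H' = ∑ H' ∈ H.powerset, edgeSetWeight x H' := by
      have h1 := sum_surjSeries_filter x H fun _ => True
      rw [Finset.filter_true] at h1
      rw [h1, ← expSeries_sum_eq_sum_edgeSetWeight]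
      ext E
      rw [PowerSeries.coeff_mk, coeff_expSeries, Finset.filter_true, Finset.sum_pow']
    rw [← Finset.insert_erase (Finset.mem_powerset_self H),
      Finset.sum_insert (Finset.notMem_erase _ _), Finset.sum_insert (Finset.notMem_erase _ _),
      Finset.sum_congr rfl (g := edgeSetWeight x)] at h
    · exact add_right_cancel h
    · intro H' hH'
      rw [Finset.mem_erase, Finset.mem_powerset] at hH'
      exact ih H' (hH'.2.ssubset_of_ne hH'.1)

end MayerExpansion

/-! ### Connected components -/

/-- Two vertices are joined by a path in the set of edges `H`. -/
def Linked (H : Finset (ℕ × ℕ)) : ℕ → ℕ → Prop :=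
  Relation.ReflTransGen fun u v => (u, v) ∈ H ∨ (v, u) ∈ H

theorem Linked.symm {H : Finset (ℕ × ℕ)} {u v : ℕ} (h : Linked H u v) : Linked H v u := by
  have hs : Std.Symm fun u v => (u, v) ∈ H ∨ (v, u) ∈ H := ⟨fun _ _ h => h.symm⟩
  exact Relation.ReflTransGen.stdSymm.symm _ _ h

theorem Linked.mono {H H' : Finset (ℕ × ℕ)} (hH : H ⊆ H') {u v : ℕ} (h : Linked H u v) :
    Linked H' u v := by
  induction h with
  | refl => exact Relation.ReflTransGen.refl
  | tail _ h ih => exact ih.tail (h.imp (@hH _) (@hH _))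

/-- All vertices in `C` are linked by `H`. -/
def LinkedOn (C : Finset ℕ) (H : Finset (ℕ × ℕ)) : Prop :=
  ∀ u ∈ C, ∀ v ∈ C, Linked H u v

section Components

variable {S C : Finset ℕ} {r : ℕ} {H H₁ H₂ : Finset (ℕ × ℕ)}

theorem mem_of_adj (hH : H ⊆ edgesOn S) {u v : ℕ} (h : (u, v) ∈ H ∨ (v, u) ∈ H) :
    u ∈ S ∧ v ∈ S := by
  rcases h with h | h
  · exact (mem_edgesOn.mp (hH h)).1
  · exact (mem_edgesOn.mp (hH h)).1.symm

theorem edgesOn_disjoint (S C : Finset ℕ) : Disjoint (edgesOn C) (edgesOn (S \ C)) := by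
  rw [Finset.disjoint_left]
  intro e he he'
  exact (Finset.mem_sdiff.mp (mem_edgesOn.mp he').1.1).2 (mem_edgesOn.mp he).1.1

open Classical in
/-- The connected component of `r`. -/
noncomputable def componentOf (S : Finset ℕ) (r : ℕ) (H : Finset (ℕ × ℕ)) : Finset ℕ :=
  S.filter (Linked H r)

theorem mem_componentOf {u : ℕ} : u ∈ componentOf S r H ↔ u ∈ S ∧ Linked H r u := by
  simp [componentOf]

theorem mem_componentOf_iff_of_adj (hH : H ⊆ edgesOn S) {u v : ℕ}
    (h : (u, v) ∈ H ∨ (v, u) ∈ H) : u ∈ componentOf S r H ↔ v ∈ componentOf S r H := by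
  obtain ⟨hu, hv⟩ := mem_of_adj hH h
  rw [mem_componentOf, mem_componentOf]
  exact ⟨fun hl => ⟨hv, hl.2.tail h⟩, fun hl => ⟨hu, hl.2.tail h.symm⟩⟩

theorem subset_edgesOn_componentOf_union (hH : H ⊆ edgesOn S) :
    H ⊆ edgesOn (componentOf S r H) ∪ edgesOn (S \ componentOf S r H) := by
  rintro ⟨u, v⟩ he
  obtain ⟨⟨hu, hv⟩, hlt⟩ := mem_edgesOn.mp (hH he)
  have hiff := mem_componentOf_iff_of_adj (r := r) hH (Or.inl he)
  rw [Finset.mem_union, mem_edgesOn, mem_edgesOn, Finset.mem_sdiff, Finset.mem_sdiff]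
  by_cases h : u ∈ componentOf S r H
  · exact Or.inl ⟨⟨h, hiff.mp h⟩, hlt⟩
  · exact Or.inr ⟨⟨⟨hu, h⟩, ⟨hv, fun h' => h (hiff.mpr h')⟩⟩, hlt⟩

/-- A path that starts at `r` never leaves the component of `r`, so it uses only edges within it. -/
theorem linkedOn_componentOf (hH : H ⊆ edgesOn S) :
    LinkedOn (componentOf S r H) (H ∩ edgesOn (componentOf S r H)) := by
  have key : ∀ u, Linked H r u → Linked (H ∩ edgesOn (componentOf S r H)) r u := by
    intro u hu
    induction hu with
    | refl => exact Relation.ReflTransGen.refl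
    | tail hb hbc ih =>
      refine ih.tail ?_
      have hmem : ∀ {u v : ℕ}, (u, v) ∈ H → Linked H r u → Linked H r v →
          (u, v) ∈ H ∩ edgesOn (componentOf S r H) := by
        intro u v he hu hv
        obtain ⟨⟨huS, hvS⟩, hlt⟩ := mem_edgesOn.mp (hH he)
        exact Finset.mem_inter.mpr ⟨he, mem_edgesOn.mpr
          ⟨⟨mem_componentOf.mpr ⟨huS, hu⟩, mem_componentOf.mpr ⟨hvS, hv⟩⟩, hlt⟩⟩
      have hc := Relation.ReflTransGen.tail hb hbc
      rcases hbc with h | h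
      · exact Or.inl (hmem h hb hc)
      · exact Or.inr (hmem h hc hb)
  intro u hu v hv
  exact (key u (mem_componentOf.mp hu).2).symm.trans (key v (mem_componentOf.mp hv).2)

/-- No edge of `H₂` touches `C` and no edge of `H₁` leaves it, so a path from `r` stays in `C`. -/
theorem componentOf_union (hCS : C ⊆ S) (hr : r ∈ C) (h₁ : H₁ ⊆ edgesOn C)
    (hc : LinkedOn C H₁) (h₂ : H₂ ⊆ edgesOn (S \ C)) : componentOf S r (H₁ ∪ H₂) = C := by
  have key : ∀ u, Linked (H₁ ∪ H₂) r u → u ∈ C := by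
    intro u hu
    induction hu with
    | refl => exact hr
    | @tail b c _ hbc ih =>
      have h : ((b, c) ∈ H₁ ∨ (c, b) ∈ H₁) ∨ ((b, c) ∈ H₂ ∨ (c, b) ∈ H₂) := by
        simp only [Finset.mem_union] at hbc
        tauto
      rcases h with h | h
      · exact (mem_of_adj h₁ h).2
      · exact absurd ih (Finset.mem_sdiff.mp (mem_of_adj h₂ h).1).2
  ext u
  rw [mem_componentOf]
  exact ⟨fun h => key u h.2,
    fun h => ⟨hCS h, (hc r hr u h).mono Finset.subset_union_left⟩⟩

open Classical in
/-- The sum over sets of edges, arranged by the connected component of the vertex `r`. -/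
theorem sum_prod_edges_eq {R : Type} [CommRing R] (w : ℕ × ℕ → R) {S : Finset ℕ} {r : ℕ}
    (hr : r ∈ S) :
    ∑ H ∈ (edgesOn S).powerset, ∏ e ∈ H, w e =
      ∑ C ∈ S.powerset with r ∈ C,
        (∑ H ∈ (edgesOn C).powerset with LinkedOn C H, ∏ e ∈ H, w e) *
          ∑ H ∈ (edgesOn (S \ C)).powerset, ∏ e ∈ H, w e := by
  have hmaps : ∀ H ∈ (edgesOn S).powerset, componentOf S r H ∈ S.powerset.filter (r ∈ ·) :=
    fun H _ => Finset.mem_filter.mpr ⟨Finset.mem_powerset.mpr (Finset.filter_subset _ _),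
      mem_componentOf.mpr ⟨hr, Relation.ReflTransGen.refl⟩⟩
  rw [← Finset.sum_fiberwise_of_maps_to hmaps]
  refine Finset.sum_congr rfl fun C hC => ?_
  rw [Finset.mem_filter, Finset.mem_powerset] at hC
  obtain ⟨hCS, hrC⟩ := hC
  have hsub : ∀ T ⊆ S, edgesOn T ⊆ edgesOn S := fun T hT e he =>
    mem_edgesOn.mpr ⟨⟨hT (mem_edgesOn.mp he).1.1, hT (mem_edgesOn.mp he).1.2⟩,
      (mem_edgesOn.mp he).2⟩
  rw [Finset.sum_mul_sum, ← Finset.sum_product']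
  -- No edge joins the component `C` to its complement, so `H` splits into its part on `C`, which
  -- must be connected, and an arbitrary set of edges on `S \ C`.
  refine Finset.sum_bij' (fun H _ => (H ∩ edgesOn C, H ∩ edgesOn (S \ C)))
    (fun p _ => p.1 ∪ p.2) ?_ ?_ ?_ ?_ ?_
  · intro H hH
    obtain ⟨hHS, rfl⟩ := Finset.mem_filter.mp hH
    rw [Finset.mem_powerset] at hHS
    simp only [Finset.mem_product, Finset.mem_filter, Finset.mem_powerset]
    exact ⟨⟨Finset.inter_subset_right, linkedOn_componentOf hHS⟩, Finset.inter_subset_right⟩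
  · rintro ⟨H₁, H₂⟩ hp
    simp only [Finset.mem_product, Finset.mem_filter, Finset.mem_powerset] at hp ⊢
    exact ⟨Finset.union_subset (hp.1.1.trans (hsub _ hCS))
      (hp.2.trans (hsub _ Finset.sdiff_subset)), componentOf_union hCS hrC hp.1.1 hp.1.2 hp.2⟩
  · intro H hH
    obtain ⟨hHS, rfl⟩ := Finset.mem_filter.mp hH
    rw [Finset.mem_powerset] at hHS
    rw [← Finset.inter_union_distrib_left]
    exact Finset.inter_eq_left.mpr
      (subset_edgesOn_componentOf_union hHS)
  · rintro ⟨H₁, H₂⟩ hp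
    simp only [Finset.mem_product, Finset.mem_filter, Finset.mem_powerset] at hp
    have hd := edgesOn_disjoint S C
    have e1 : H₁ ∩ edgesOn (S \ C) = ∅ :=
      Finset.disjoint_iff_inter_eq_empty.mp (hd.mono_left hp.1.1)
    have e2 : H₂ ∩ edgesOn C = ∅ :=
      Finset.disjoint_iff_inter_eq_empty.mp (hd.symm.mono_left hp.2)
    simp only [Finset.union_inter_distrib_right, e1, e2, Finset.inter_eq_left.mpr hp.1.1,
      Finset.inter_eq_left.mpr hp.2, Finset.union_empty, Finset.empty_union]
  · intro H hH
    obtain ⟨hHS, rfl⟩ := Finset.mem_filter.mp hH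
    rw [Finset.mem_powerset] at hHS
    rw [← Finset.prod_union ((edgesOn_disjoint S _).mono Finset.inter_subset_right
      Finset.inter_subset_right), ← Finset.inter_union_distrib_left,
      Finset.inter_eq_left.mpr (subset_edgesOn_componentOf_union hHS)]

end Components

/-! ### Recursion for Moyal powers -/

section ConnectedSeries

variable {N : ℕ}

open Classical in
/-- The sum over the connected graphs on the vertices in `C` of their operators. -/
noncomputable def connectedSeries (N : ℕ) (C : Finset ℕ) : PowerSeries (VertexAlgebra N) :=
  ∑ H ∈ (edgesOn C).powerset with LinkedOn C H, edgeSetWeight (fun e => edgeOp N e.1 e.2) H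

theorem connectedSeries_mem (C : Finset ℕ) : connectedSeries N C ∈ supportedSeries N C := by
  classical
  refine Subalgebra.sum_mem _ fun H hH => Subalgebra.prod_mem _ fun e he =>
    Subalgebra.sub_mem _ (expSeries_mem ?_) (Subalgebra.one_mem _)
  have := mem_edgesOn.mp (Finset.mem_powerset.mp (Finset.mem_filter.mp hH).1 he)
  exact edgeOp_mem this.1.1 this.1.2

theorem graphSeries_eq_sum (S : Finset ℕ) :
    graphSeries N S =
      ∑ H ∈ (edgesOn S).powerset, edgeSetWeight (fun e => edgeOp N e.1 e.2) H :=
  expSeries_sum_eq_sum_edgeSetWeight _ _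

/-- Edges away from the component of `r` are unrestricted, so they resum to the full series on `S \
C`. -/
theorem graphSeries_eq_sum_connectedSeries {S : Finset ℕ} {r : ℕ} (hr : r ∈ S) :
    graphSeries N S =
      ∑ C ∈ S.powerset with r ∈ C, connectedSeries N C * graphSeries N (S \ C) := by
  classical
  simp only [graphSeries_eq_sum, connectedSeries, edgeSetWeight]
  convert sum_prod_edges_eq _ hr

/-- The recursion for Moyal powers obtained from the connected component of one vertex. -/
theorem moyalPow_succ_eq_sum (A : FormalSymbol N) (K : ℕ → FormalSymbol N)
    (hK : ∀ C : Finset ℕ, evalSeries A C (connectedSeries N C) = K C.card) (n : ℕ) :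
    moyalPow A (n + 1) =
      ∑ k ∈ Finset.range (n + 1), (n.choose k : ℂ) • (K (k + 1) * moyalPow A (n - k)) := by
  have hn : n ∉ Finset.range n := Finset.notMem_range_self
  have h1 : moyalPow A (n + 1) =
      evalSeries A (Finset.range (n + 1)) (graphSeries N (Finset.range (n + 1))) := by
    rw [evalSeries_graphSeries, Finset.card_range]
  rw [h1, Finset.range_add_one,
    graphSeries_eq_sum_connectedSeries (Finset.mem_insert_self n _), map_sum]
  have h2 : ∀ C ∈ (insert n (Finset.range n)).powerset.filter (n ∈ ·),
      evalSeries A (insert n (Finset.range n))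
        (connectedSeries N C * graphSeries N (insert n (Finset.range n) \ C)) =
        K C.card * moyalPow A (n + 1 - C.card) := by
    intro C hC
    rw [Finset.mem_filter, Finset.mem_powerset] at hC
    have h3 := evalSeries_mul A Finset.disjoint_sdiff (connectedSeries_mem (N := N) C)
      (graphSeries_mem (insert n (Finset.range n) \ C))
    rw [Finset.union_sdiff_of_subset hC.1] at h3
    rw [h3, hK, evalSeries_graphSeries, Finset.card_sdiff_of_subset hC.1,
      Finset.card_insert_of_notMem hn, Finset.card_range]
  rw [Finset.sum_congr rfl h2]
  -- With the root `n` removed, the components are arbitrary subsets of the other `n` vertices;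
  -- there are `n.choose k` of size `k`.
  have h3 : ∑ C ∈ (Finset.range n).powerset,
      K (C.card + 1) * moyalPow A (n - C.card) =
      ∑ k ∈ Finset.range (n + 1), (n.choose k : ℂ) • (K (k + 1) * moyalPow A (n - k)) := by
    rw [Finset.sum_powerset_apply_card fun k => K (k + 1) * moyalPow A (n - k),
      Finset.card_range]
    simp only [Nat.cast_smul_eq_nsmul]
  rw [← Finset.range_add_one, ← h3]
  refine Finset.sum_bij' (fun C _ => C.erase n) (fun C _ => insert n C) ?_ ?_ ?_ ?_ ?_
  · intro C hC
    rw [Finset.mem_filter, Finset.mem_powerset, Finset.range_add_one] at hC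
    rw [Finset.mem_powerset]
    exact (Finset.erase_subset_erase n hC.1).trans (Finset.erase_insert hn).subset
  · intro C hC
    rw [Finset.mem_powerset] at hC
    rw [Finset.mem_filter, Finset.mem_powerset, Finset.range_add_one]
    exact ⟨Finset.insert_subset_insert n hC, Finset.mem_insert_self n C⟩
  · intro C hC
    exact Finset.insert_erase (Finset.mem_filter.mp hC).2
  · intro C hC
    exact Finset.erase_insert fun h => hn (Finset.mem_powerset.mp hC h)
  · intro C hC
    have hnC := (Finset.mem_filter.mp hC).2
    have hpos : 0 < C.card := Finset.card_pos.mpr ⟨n, hnC⟩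
    rw [Finset.card_erase_of_mem hnC, Nat.sub_add_cancel hpos]
    congr 2
    omega

end ConnectedSeries

/-! ### The operators of labeled graphs -/

namespace LabeledGraph

variable {V E : ℕ}

theorem card_edge (Γ : LabeledGraph V E) (e : Fin E) : (Γ e : Finset (Fin V)).card = 2 := (Γ e).2

theorem src_mem (Γ : LabeledGraph V E) (e : Fin E) : Γ.src e ∈ (Γ e : Finset (Fin V)) :=
  Finset.min'_mem _ _

theorem tgt_mem (Γ : LabeledGraph V E) (e : Fin E) : Γ.tgt e ∈ (Γ e : Finset (Fin V)) :=
  Finset.max'_mem _ _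

theorem src_lt_tgt (Γ : LabeledGraph V E) (e : Fin E) : Γ.src e < Γ.tgt e :=
  Finset.min'_lt_max'_of_card _ (by rw [card_edge]; norm_num)

theorem edge_eq (Γ : LabeledGraph V E) (e : Fin E) :
    (Γ e : Finset (Fin V)) = {Γ.src e, Γ.tgt e} := by
  refine (Finset.eq_of_subset_of_card_le ?_ ?_).symm
  · intro v hv
    rw [Finset.mem_insert, Finset.mem_singleton] at hv
    rcases hv with rfl | rfl
    · exact Γ.src_mem e
    · exact Γ.tgt_mem e
  · rw [card_edge, Finset.card_pair (Γ.src_lt_tgt e).ne]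

theorem mem_edge (Γ : LabeledGraph V E) (e : Fin E) (v : Fin V) :
    v ∈ (Γ e : Finset (Fin V)) ↔ v = Γ.src e ∨ v = Γ.tgt e := by
  rw [edge_eq, Finset.mem_insert, Finset.mem_singleton]

theorem src_eq_of_edge_eq {Γ : LabeledGraph V E} {e : Fin E} {a b : Fin V} (hab : a < b)
    (h : (Γ e : Finset (Fin V)) = {a, b}) : Γ.src e = a := by
  simp only [src, h]
  rw [Finset.min'_pair, min_eq_left hab.le]

theorem tgt_eq_of_edge_eq {Γ : LabeledGraph V E} {e : Fin E} {a b : Fin V} (hab : a < b)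
    (h : (Γ e : Finset (Fin V)) = {a, b}) : Γ.tgt e = b := by
  simp only [tgt, h]
  rw [Finset.max'_pair, max_eq_right hab.le]

theorem ext_of_endpoints {Γ Γ' : LabeledGraph V E} (h : ∀ e, Γ.src e = Γ'.src e)
    (h' : ∀ e, Γ.tgt e = Γ'.tgt e) : Γ = Γ' := by
  funext e
  refine Subtype.ext ?_
  rw [edge_eq, edge_eq, h, h']

/-- The labeled graph with given endpoints. -/
def ofEndpoints (a b : Fin E → Fin V) (hab : ∀ e, a e < b e) : LabeledGraph V E :=
  fun e => ⟨{a e, b e}, Finset.card_pair (hab e).ne⟩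

theorem src_ofEndpoints {a b : Fin E → Fin V} (hab : ∀ e, a e < b e) (e : Fin E) :
    (ofEndpoints a b hab).src e = a e := src_eq_of_edge_eq (hab e) rfl

theorem tgt_ofEndpoints {a b : Fin E → Fin V} (hab : ∀ e, a e < b e) (e : Fin E) :
    (ofEndpoints a b hab).tgt e = b e := tgt_eq_of_edge_eq (hab e) rfl

noncomputable instance : Fintype (LabeledGraph V E) := Fintype.ofFinite _

variable {N : ℕ}

theorem coe_filterMap_eq_sum {α β : Type*} (f : α → Option β) (l : List α) :
    ((l.filterMap f : List β) : Multiset β) =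
      (l.map fun a => ((f a).toList : Multiset β)).sum := by
  induction l with
  | nil => rfl
  | cons a l ih =>
    rw [List.map_cons, List.sum_cons, ← ih]
    cases h : f a with
    | none => simp [List.filterMap_cons_none h]
    | some b => simp [List.filterMap_cons_some h]

theorem coe_indicesAt (Γ : LabeledGraph V E) (μ ν : Fin E → CoordIndex N) (v : Fin V) :
    (Γ.indicesAt μ ν v : Multiset (CoordIndex N)) =
      ∑ e, ((if Γ.src e = v then {μ e} else 0) + (if Γ.tgt e = v then {ν e} else 0)) := by
  rw [indicesAt, coe_filterMap_eq_sum, Fin.sum_univ_def]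
  congr 2
  funext e
  -- The endpoints of an edge differ, so the nested conditional in `indicesAt` never hides the
  -- second contribution.
  by_cases h : Γ.src e = v
  · have h' : Γ.tgt e ≠ v := by
      rw [← h]
      exact (Γ.src_lt_tgt e).ne'
    simp [h, h']
  · by_cases h' : Γ.tgt e = v <;> simp [h, h']

/-- The weighted operator of a graph as a product over its edges. -/
theorem smul_lam_eq_evalAt (A : FormalSymbol N) (Γ : LabeledGraph V E) {φ : Fin V → ℕ}
    (hφ : Function.Injective φ) :
    (Complex.I / 2) ^ E • Γ.lam (fun _ => A) =
      evalAt A (Finset.univ.image φ) (∏ e, edgeOp N (φ (Γ.src e)) (φ (Γ.tgt e))) := by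
  simp only [edgeOp]
  rw [Finset.prod_smul, Fin.prod_const, map_smul, prod_sum_sum, map_sum, lam]
  congr 1
  refine Finset.sum_congr rfl fun μ _ => ?_
  rw [map_sum]
  refine Finset.sum_congr rfl fun ν _ => ?_
  rw [Finset.prod_smul, map_smul]
  congr 1
  simp only [vertexDeriv, AddMonoidAlgebra.single_mul_single, mul_one]
  rw [AddMonoidAlgebra.prod_single, evalAt_single, Finset.prod_const_one, one_smul,
    Finset.prod_image fun a _ b _ h => hφ h]
  refine Finset.prod_congr rfl fun v _ => ?_
  rw [iterPderiv_eq_multiDeriv, coe_indicesAt, Finset.sum_apply]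
  congr 1
  refine Finset.sum_congr rfl fun e _ => ?_
  rw [Pi.add_apply, Pi.single_apply, Pi.single_apply]
  simp only [hφ.eq_iff, eq_comm]

/-- Paths in a graph correspond to paths in the set of its edges. -/
theorem preconnected_iff_linkedOn (Γ : LabeledGraph V E) {φ : Fin V → ℕ}
    (hφ : Function.Injective φ) :
    Γ.toSimpleGraph.Preconnected ↔ LinkedOn (Finset.univ.image φ)
      (Finset.univ.image fun e => (φ (Γ.src e), φ (Γ.tgt e))) := by
  set H : Finset (ℕ × ℕ) := Finset.univ.image fun e => (φ (Γ.src e), φ (Γ.tgt e)) with hH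
  have hmem : ∀ {a b : ℕ}, (a, b) ∈ H ↔ ∃ e, φ (Γ.src e) = a ∧ φ (Γ.tgt e) = b := by
    simp [hH]
  have hadj : ∀ {u v : Fin V}, Γ.toSimpleGraph.Adj u v →
      (φ u, φ v) ∈ H ∨ (φ v, φ u) ∈ H := by
    rintro u v ⟨hne, e, hu, hv⟩
    rw [mem_edge] at hu hv
    rcases hu with rfl | rfl <;> rcases hv with rfl | rfl
    · exact absurd rfl hne
    · exact Or.inl (hmem.mpr ⟨e, rfl, rfl⟩)
    · exact Or.inr (hmem.mpr ⟨e, rfl, rfl⟩)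
    · exact absurd rfl hne
  have hadj' : ∀ e, Γ.toSimpleGraph.Adj (Γ.src e) (Γ.tgt e) := fun e =>
    ⟨(Γ.src_lt_tgt e).ne, e, Γ.src_mem e, Γ.tgt_mem e⟩
  constructor
  · intro h a ha b hb
    obtain ⟨u, -, rfl⟩ := Finset.mem_image.mp ha
    obtain ⟨v, -, rfl⟩ := Finset.mem_image.mp hb
    have huv := (SimpleGraph.reachable_iff_reflTransGen u v).mp (h u v)
    clear ha hb
    induction huv with
    | refl => exact Relation.ReflTransGen.refl
    | tail _ hbc ih =>
      exact ih.tail (hadj hbc)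
  · intro h u v
    -- A path in `ℕ` from `φ u` has to be lifted: all its vertices lie in the image of `φ`, as
    -- endpoints of edges in `H`.
    have key : ∀ b, Linked H (φ u) b → ∃ w, φ w = b ∧ Γ.toSimpleGraph.Reachable u w := by
      intro b hb
      induction hb with
      | refl => exact ⟨u, rfl, SimpleGraph.Reachable.refl u⟩
      | tail _ hbc ih =>
        obtain ⟨w, rfl, hw⟩ := ih
        rcases hbc with hbc | hbc
        · obtain ⟨e, he, rfl⟩ := hmem.mp hbc
          exact ⟨_, rfl, hw.trans (hφ he ▸ (hadj' e).reachable)⟩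
        · obtain ⟨e, rfl, he⟩ := hmem.mp hbc
          exact ⟨_, rfl, hw.trans (hφ he ▸ (hadj' e).symm.reachable)⟩
    obtain ⟨w, hw, hr⟩ := key _ (h _ (Finset.mem_image_of_mem φ (Finset.mem_univ u)) _
      (Finset.mem_image_of_mem φ (Finset.mem_univ v)))
    exact hφ hw ▸ hr

end LabeledGraph

/-! ### Connected series as sums over labeled graphs -/

section ConnectedSum

variable {N : ℕ}

open Classical in
/-- The sum over the connected labeled graphs with `k` vertices. -/
noncomputable def connectedLabeledSum (A : FormalSymbol N) (k : ℕ) : FormalSymbol N :=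
  hbarSum fun E => ((Complex.I / 2) ^ E / (E.factorial : ℂ)) •
    ∑ Γ : LabeledGraph k E with Γ.toSimpleGraph.Preconnected, Γ.lam fun _ => A

/-- A sequence of `E` pairs `u < v` in `C` is the same as a labeled graph with `C.card` vertices and
`E` edges. In particular the value depends on `C.card` only, as the recursion requires. -/
theorem evalSeries_connectedSeries (A : FormalSymbol N) (C : Finset ℕ) :
    evalSeries A C (connectedSeries N C) = connectedLabeledSum A C.card := by
  classical
  have h1 : connectedSeries N C = PowerSeries.mk fun E => (1 / (E.factorial : ℂ)) •
      ∑ γ ∈ (Fintype.piFinset fun _ : Fin E => edgesOn C) with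
        LinkedOn C (Finset.univ.image γ), ∏ i, edgeOp N (γ i).1 (γ i).2 := by
    refine Eq.trans ?_ (sum_surjSeries_filter (fun e : ℕ × ℕ => edgeOp N e.1 e.2) (edgesOn C)
      (LinkedOn C))
    simp only [connectedSeries, surjSeries_eq]
  rw [h1, evalSeries_apply, connectedLabeledSum]
  refine hbarSum_congr fun E => ?_
  rw [PowerSeries.coeff_mk, map_smul, map_sum, div_eq_mul_one_div ((Complex.I / 2) ^ E),
    mul_comm ((Complex.I / 2) ^ E), mul_smul]
  congr 1
  rw [Finset.smul_sum]
  -- The increasing enumeration of `C` preserves the orientation of edges, so no signs appear.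
  set φ : Fin C.card ↪o ℕ := C.orderEmbOfFin rfl with hφ
  have himg : Finset.univ.image φ = C := by
    rw [← Finset.coe_inj, Finset.coe_image, Finset.coe_univ, Set.image_univ]
    exact Finset.range_orderEmbOfFin C rfl
  have hmem : ∀ v, φ v ∈ C := fun v => Finset.orderEmbOfFin_mem C rfl v
  symm
  refine Finset.sum_bij (fun (Γ : LabeledGraph C.card E) _ (e : Fin E) => (φ (Γ.src e), φ (Γ.tgt e))) ?_ ?_ ?_ ?_
  · intro Γ hΓ
    have h := (Finset.mem_filter.mp hΓ).2
    rw [Γ.preconnected_iff_linkedOn φ.injective, himg] at h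
    refine Finset.mem_filter.mpr ⟨Fintype.mem_piFinset.mpr fun e => ?_, h⟩
    exact mem_edgesOn.mpr ⟨⟨hmem _, hmem _⟩, φ.lt_iff_lt.mpr (Γ.src_lt_tgt e)⟩
  · intro Γ _ Γ' _ h
    refine LabeledGraph.ext_of_endpoints (fun e => ?_) fun e => ?_
    · exact φ.injective (Prod.mk.inj (congrFun h e)).1
    · exact φ.injective (Prod.mk.inj (congrFun h e)).2
  · intro γ hγ
    obtain ⟨hγ, hl⟩ := Finset.mem_filter.mp hγ
    rw [Fintype.mem_piFinset] at hγ
    have hsurj : ∀ c ∈ C, ∃ v, φ v = c := fun c hc => by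
      rw [← himg] at hc
      obtain ⟨v, _, hv⟩ := Finset.mem_image.mp hc
      exact ⟨v, hv⟩
    choose a ha using fun e => hsurj _ (mem_edgesOn.mp (hγ e)).1.1
    choose b hb using fun e => hsurj _ (mem_edgesOn.mp (hγ e)).1.2
    have hab : ∀ e, a e < b e := fun e => by
      rw [← φ.lt_iff_lt, ha, hb]
      exact (mem_edgesOn.mp (hγ e)).2
    have hγeq : (fun e => (φ ((LabeledGraph.ofEndpoints a b hab).src e),
        φ ((LabeledGraph.ofEndpoints a b hab).tgt e))) = γ := by
      funext e
      rw [LabeledGraph.src_ofEndpoints, LabeledGraph.tgt_ofEndpoints, ha, hb]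
    refine ⟨LabeledGraph.ofEndpoints a b hab, Finset.mem_filter.mpr ⟨Finset.mem_univ _, ?_⟩, hγeq⟩
    rw [LabeledGraph.preconnected_iff_linkedOn _ φ.injective, himg, hγeq]
    exact hl
  · intro Γ _
    rw [LabeledGraph.smul_lam_eq_evalAt A Γ φ.injective, himg]

end ConnectedSum

/-! ### Sums over unlabeled graphs -/

/-- The sum over orbits, weighted by the inverse orders of the stabilizers. -/
theorem sum_orbits_eq {G X M : Type*} [Group G] [Fintype G] [MulAction G X] [Fintype X]
    [Fintype (MulAction.orbitRel.Quotient G X)] [AddCommGroup M] [Module ℂ M] (F : X → M)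
    (hF : ∀ (g : G) (x : X), F (g • x) = F x)
    (rep : MulAction.orbitRel.Quotient G X → X)
    (hrep : ∀ q, (Quotient.mk'' (rep q) : MulAction.orbitRel.Quotient G X) = q) :
    ∑ q, (1 / (Nat.card (MulAction.stabilizer G (rep q)) : ℂ)) • F (rep q) =
      (1 / (Fintype.card G : ℂ)) • ∑ x, F x := by
  classical
  rw [← Finset.sum_fiberwise (g := fun x => (Quotient.mk'' x : MulAction.orbitRel.Quotient G X)),
    Finset.smul_sum]
  refine Finset.sum_congr rfl fun q _ => ?_
  have hiff : ∀ x, (Quotient.mk'' x : MulAction.orbitRel.Quotient G X) = q ↔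
      x ∈ MulAction.orbit G (rep q) := fun x => by
    conv_lhs => rw [← hrep q]
    rw [Quotient.eq'', MulAction.orbitRel_apply]
  have hsum : ∑ x with (Quotient.mk'' x : MulAction.orbitRel.Quotient G X) = q, F x =
      ∑ x with (Quotient.mk'' x : MulAction.orbitRel.Quotient G X) = q, F (rep q) := by
    refine Finset.sum_congr rfl fun x hx => ?_
    obtain ⟨g, rfl⟩ := (hiff x).mp (Finset.mem_filter.mp hx).2
    exact hF g _
  have hcard : (Finset.univ.filter fun x =>
      (Quotient.mk'' x : MulAction.orbitRel.Quotient G X) = q).card =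
      Fintype.card (MulAction.orbit G (rep q)) := by
    rw [Fintype.card_subtype]
    simp only [hiff]
  -- The orbit-stabilizer theorem turns the size of the fiber over `q` into `|G|` divided by the
  -- order of the stabilizer.
  have hos := MulAction.card_orbit_mul_card_stabilizer_eq_card_group G (rep q)
  rw [hsum, Finset.sum_const, hcard, ← Nat.cast_smul_eq_nsmul ℂ, smul_smul,
    Nat.card_eq_fintype_card, ← hos, Nat.cast_mul]
  congr 1
  have h1 : (Fintype.card (MulAction.orbit G (rep q)) : ℂ) ≠ 0 := by
    have : Nonempty (MulAction.orbit G (rep q)) := ⟨⟨_, MulAction.mem_orbit_self _⟩⟩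
    exact Nat.cast_ne_zero.mpr Fintype.card_ne_zero
  have h2 : (Fintype.card (MulAction.stabilizer G (rep q)) : ℂ) ≠ 0 :=
    Nat.cast_ne_zero.mpr Fintype.card_ne_zero
  field_simp

namespace LabeledGraph

variable {V E N : ℕ}

theorem coe_smul_edge (g : Equiv.Perm (Fin V) × Equiv.Perm (Fin E)) (Γ : LabeledGraph V E)
    (e : Fin E) :
    ((g • Γ) e : Finset (Fin V)) =
      (({g.1 (Γ.src (g.2⁻¹ e)), g.1 (Γ.tgt (g.2⁻¹ e))} : Finset (Fin V))) := by
  change ((g.1 • Γ (g.2⁻¹ e) : Set.powersetCard (Fin V) 2) : Finset (Fin V)) = _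
  rw [Set.powersetCard.coe_smul, edge_eq, Finset.smul_finset_insert,
    Finset.smul_finset_singleton]
  rfl

theorem mem_smul_edge (g : Equiv.Perm (Fin V) × Equiv.Perm (Fin E)) (Γ : LabeledGraph V E)
    (e : Fin E) (v : Fin V) :
    v ∈ ((g • Γ) e : Finset (Fin V)) ↔ g.1⁻¹ v ∈ (Γ (g.2⁻¹ e) : Finset (Fin V)) := by
  rw [coe_smul_edge, mem_edge, Finset.mem_insert, Finset.mem_singleton, Equiv.Perm.inv_eq_iff_eq,
    Equiv.Perm.inv_eq_iff_eq, eq_comm, @eq_comm _ _ v]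

theorem IsConnectedReduced.smul {Γ : LabeledGraph V E} (h : Γ.IsConnectedReduced)
    (g : Equiv.Perm (Fin V) × Equiv.Perm (Fin E)) : (g • Γ).IsConnectedReduced := by
  refine ⟨?_, ?_, h.2.2⟩
  · refine h.1.map (⟨g.1, ?_⟩ : Γ.toSimpleGraph →g (g • Γ).toSimpleGraph) g.1.surjective
    rintro u v ⟨hne, e, hu, hv⟩
    refine ⟨fun h => hne (g.1.injective h), g.2 e, ?_, ?_⟩
    · simpa [mem_smul_edge] using hu
    · simpa [mem_smul_edge] using hv
  · intro v
    obtain ⟨e, he⟩ := h.2.1 (g.1⁻¹ v)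
    exact ⟨g.2 e, by simpa [mem_smul_edge] using he⟩

theorem isConnectedReduced_smul_iff (g : Equiv.Perm (Fin V) × Equiv.Perm (Fin E))
    (Γ : LabeledGraph V E) : (g • Γ).IsConnectedReduced ↔ Γ.IsConnectedReduced :=
  ⟨fun h => by simpa using h.smul g⁻¹, fun h => h.smul g⟩

/-- The sign of a relabeling `σ` of the vertices. -/
def inversionSign (Γ : LabeledGraph V E) (σ : Equiv.Perm (Fin V)) : ℤ :=
  (-1) ^ (Finset.univ.filter fun e : Fin E => σ (Γ.tgt e) < σ (Γ.src e)).card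

/-- The relabeled graph orients its edges anew by the new labels; each inverted edge costs a sign.
-/
theorem edgeOp_smul (g : Equiv.Perm (Fin V) × Equiv.Perm (Fin E)) (Γ : LabeledGraph V E)
    (e : Fin E) :
    edgeOp N ((g • Γ).src e) ((g • Γ).tgt e) =
      (if g.1 (Γ.tgt (g.2⁻¹ e)) < g.1 (Γ.src (g.2⁻¹ e)) then -1 else 1) *
        edgeOp N (g.1 (Γ.src (g.2⁻¹ e))) (g.1 (Γ.tgt (g.2⁻¹ e))) := by
  have h := coe_smul_edge g Γ e
  split_ifs with hlt
  · rw [Finset.pair_comm] at h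
    rw [src_eq_of_edge_eq hlt h, tgt_eq_of_edge_eq hlt h, edgeOp_swap, neg_one_mul]
  · have hlt' : g.1 (Γ.src (g.2⁻¹ e)) < g.1 (Γ.tgt (g.2⁻¹ e)) :=
      lt_of_le_of_ne (not_lt.mp hlt) fun heq =>
        (Γ.src_lt_tgt (g.2⁻¹ e)).ne (g.1.injective heq)
    rw [src_eq_of_edge_eq hlt' h, tgt_eq_of_edge_eq hlt' h, one_mul]

/-- Relabeling the vertices and edges of a graph changes `λ_Γ(A)` by a sign. -/
theorem smul_lam_smul (A : FormalSymbol N) (g : Equiv.Perm (Fin V) × Equiv.Perm (Fin E))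
    (Γ : LabeledGraph V E) :
    (Complex.I / 2) ^ E • (g • Γ).lam (fun _ => A) =
      (Γ.inversionSign g.1 : ℂ) • (Complex.I / 2) ^ E • Γ.lam (fun _ => A) := by
  -- Both graphs are evaluated on the same copies of `A`: `Γ` with its vertices placed by `g.1`, and
  -- `g • Γ` with the standard placement. The products over edges then differ only by signs and the
  -- order of the factors.
  have hφ : Function.Injective fun v : Fin V => ((g.1 v : Fin V) : ℕ) :=
    Fin.val_injective.comp g.1.injective
  rw [smul_lam_eq_evalAt A (g • Γ) (φ := fun v => (v : ℕ)) Fin.val_injective,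
    smul_lam_eq_evalAt A Γ hφ]
  have himg : (Finset.univ.image fun v : Fin V => ((g.1 v : Fin V) : ℕ)) =
      Finset.univ.image fun v : Fin V => (v : ℕ) := by
    ext a
    simp only [Finset.mem_image, Finset.mem_univ, true_and]
    exact ⟨fun ⟨v, hv⟩ => ⟨g.1 v, hv⟩, fun ⟨v, hv⟩ => ⟨g.1⁻¹ v, by simpa using hv⟩⟩
  rw [himg, ← map_smul]
  congr 1
  simp only [edgeOp_smul]
  rw [Equiv.prod_comp g.2⁻¹ fun e => (if g.1 (Γ.tgt e) < g.1 (Γ.src e) then -1 else 1) *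
    edgeOp N (g.1 (Γ.src e)) (g.1 (Γ.tgt e)), Finset.prod_mul_distrib, Finset.prod_ite,
    Finset.prod_const, Finset.prod_const_one, mul_one, inversionSign, Int.cast_pow, Int.cast_neg,
    Int.cast_one, Algebra.smul_def, map_pow, map_neg, map_one]

theorem lam_smul (A : FormalSymbol N) (g : Equiv.Perm (Fin V) × Equiv.Perm (Fin E))
    (Γ : LabeledGraph V E) :
    (g • Γ).lam (fun _ => A) = (Γ.inversionSign g.1 : ℂ) • Γ.lam (fun _ => A) := by
  have h := smul_lam_smul A g Γ
  rw [smul_comm] at h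
  have hne : (Complex.I / 2) ^ E ≠ 0 :=
    pow_ne_zero _ (div_ne_zero Complex.I_ne_zero two_ne_zero)
  have h' := congrArg (((Complex.I / 2) ^ E)⁻¹ • ·) h
  simpa only [inv_smul_smul₀ hne] using h'

/-- The signs summed in `c_Γ` are those by which relabelings change `λ_Γ`. Hence `c_Γ λ_Γ` does not
depend on the representative, although each factor may change sign. -/
theorem orderSum_smul_lam (A : FormalSymbol N) (Γ : LabeledGraph V E) :
    (Γ.orderSum : ℂ) • Γ.lam (fun _ => A) =
      ∑ σ : Equiv.Perm (Fin V), ((σ, (1 : Equiv.Perm (Fin E))) • Γ : LabeledGraph V E).lam fun _ => A := by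
  simp only [lam_smul]
  rw [← Finset.sum_smul, orderSum, Int.cast_sum]
  rfl

open Classical in
/-- The sum over connected graphs with a symmetry factor is a sum over labeled graphs. -/
theorem sum_unlabeledGraph_eq (A : FormalSymbol N) (V E : ℕ)
    (rep : UnlabeledGraph V E → LabeledGraph V E)
    (hrep : ∀ G, (Quotient.mk'' (rep G) : UnlabeledGraph V E) = G) :
    (∑ G : UnlabeledGraph V E, if (rep G).IsConnectedReduced then
      (((rep G).orderSum : ℂ) / ((rep G).symOrder : ℂ)) • (rep G).lam (fun _ => A) else 0) =
      (1 / (E.factorial : ℂ)) •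
        ∑ Γ : LabeledGraph V E with Γ.IsConnectedReduced, Γ.lam fun _ => A := by
  set F : LabeledGraph V E → FormalSymbol N := fun Γ => if Γ.IsConnectedReduced then
    ∑ σ : Equiv.Perm (Fin V),
      ((σ, (1 : Equiv.Perm (Fin E))) • Γ : LabeledGraph V E).lam (fun _ => A) else 0 with hF
  have hinv : ∀ (g : Equiv.Perm (Fin V) × Equiv.Perm (Fin E)) (Γ : LabeledGraph V E),
      F (g • Γ) = F Γ := by
    intro g Γ
    simp only [hF, isConnectedReduced_smul_iff]
    refine if_congr Iff.rfl ?_ rfl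
    -- Relabeling by `g.1` only translates the summation over `σ`; permuting the edges has no effect
    -- on `λ`.
    rw [← Equiv.sum_comp (Equiv.mulRight g.1)
      fun σ => ((σ, (1 : Equiv.Perm (Fin E))) • Γ : LabeledGraph V E).lam fun _ => A]
    refine Finset.sum_congr rfl fun σ _ => ?_
    rw [smul_smul, lam_smul, lam_smul]
    simp
  have h := sum_orbits_eq F hinv rep hrep
  have hterm : ∀ G, (if (rep G).IsConnectedReduced then
      (((rep G).orderSum : ℂ) / ((rep G).symOrder : ℂ)) • (rep G).lam (fun _ => A) else 0) =
      (1 / (Nat.card (MulAction.stabilizer (Equiv.Perm (Fin V) × Equiv.Perm (Fin E))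
        (rep G)) : ℂ)) • F (rep G) := by
    intro G
    simp only [hF]
    split_ifs
    · rw [← orderSum_smul_lam, smul_smul, symOrder, div_eq_mul_one_div, mul_comm]
    · rw [smul_zero]
  rw [Finset.sum_congr rfl fun G _ => hterm G, h]
  have hcard : (Fintype.card (Equiv.Perm (Fin V) × Equiv.Perm (Fin E)) : ℂ) =
      V.factorial * E.factorial := by
    rw [Fintype.card_prod, Fintype.card_perm, Fintype.card_perm, Fintype.card_fin,
      Fintype.card_fin, Nat.cast_mul]
  -- Each `σ` permutes the connected reduced labeled graphs, so the `V!` sums agree. This `V!`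
  -- cancels against the group order `V! E!` and leaves `1/E!`.
  have hsum : ∑ Γ, F Γ = (V.factorial : ℂ) •
      ∑ Γ : LabeledGraph V E with Γ.IsConnectedReduced, Γ.lam fun _ => A := by
    have h1 : ∀ Γ, F Γ = ∑ σ : Equiv.Perm (Fin V),
        if ((σ, (1 : Equiv.Perm (Fin E))) • Γ : LabeledGraph V E).IsConnectedReduced then
          ((σ, (1 : Equiv.Perm (Fin E))) • Γ : LabeledGraph V E).lam (fun _ => A) else 0 := by
      intro Γ
      simp only [hF, isConnectedReduced_smul_iff]
      split_ifs
      · rfl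
      · rw [Finset.sum_const_zero]
    simp only [h1]
    rw [Finset.sum_comm, Finset.sum_filter]
    have h2 : ∀ σ : Equiv.Perm (Fin V), (∑ Γ : LabeledGraph V E,
        if ((σ, (1 : Equiv.Perm (Fin E))) • Γ : LabeledGraph V E).IsConnectedReduced then
          ((σ, (1 : Equiv.Perm (Fin E))) • Γ : LabeledGraph V E).lam (fun _ => A) else 0) =
        ∑ Γ : LabeledGraph V E, if Γ.IsConnectedReduced then Γ.lam (fun _ => A) else 0 :=
      fun σ => Equiv.sum_comp (MulAction.toPerm (σ, (1 : Equiv.Perm (Fin E))))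
        fun Γ : LabeledGraph V E => if Γ.IsConnectedReduced then Γ.lam (fun _ => A) else 0
    simp only [h2]
    rw [Finset.sum_const, Finset.card_univ, Fintype.card_perm, Fintype.card_fin,
      Nat.cast_smul_eq_nsmul]
  rw [hsum, hcard, smul_smul]
  congr 1
  have h1 : (V.factorial : ℂ) ≠ 0 := Nat.cast_ne_zero.mpr (Nat.factorial_ne_zero _)
  have h2 : (E.factorial : ℂ) ≠ 0 := Nat.cast_ne_zero.mpr (Nat.factorial_ne_zero _)
  field_simp

end LabeledGraph

/-! ### Coefficients of formal operators -/

section OpCoeff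

variable {N : ℕ}

/-- The coefficient of `Dᵛ` in a formal operator. -/
noncomputable def opCoeff (v : ℕ) : FormalOperator N →ₗ[ℂ] FormalSymbol N where
  toFun Q := PowerSeries.mk fun n => (PowerSeries.coeff n Q).coeff v
  map_add' P Q := by
    ext1 n
    simp only [map_add, PowerSeries.coeff_mk, Polynomial.coeff_add]
  map_smul' c P := by
    ext1 n
    simp only [PowerSeries.coeff_smul, PowerSeries.coeff_mk, Polynomial.coeff_smul,
      RingHom.id_apply]

theorem coeff_opCoeff (v n : ℕ) (Q : FormalOperator N) :
    PowerSeries.coeff n (opCoeff v Q) = (PowerSeries.coeff n Q).coeff v := by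
  change PowerSeries.coeff n (PowerSeries.mk fun n => (PowerSeries.coeff n Q).coeff v) = _
  rw [PowerSeries.coeff_mk]

theorem opCoeff_hbarSum (v : ℕ) (F : ℕ → FormalOperator N) :
    opCoeff v (hbarSum F) = hbarSum fun k => opCoeff v (F k) := by
  ext1 n
  simp only [coeff_opCoeff, coeff_hbarSum, Polynomial.finsetSum_coeff]

theorem opCoeff_map_C_mul (v k : ℕ) (L : FormalSymbol N) :
    opCoeff v (PowerSeries.map Polynomial.C L * PowerSeries.C (Polynomial.X ^ k)) =
      if v = k then L else 0 := by
  ext1 n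
  rw [coeff_opCoeff, PowerSeries.coeff_mul_C, PowerSeries.coeff_map, Polynomial.coeff_C_mul_X_pow]
  split_ifs <;> simp

theorem opCoeff_mul (v : ℕ) (P Q : FormalOperator N) :
    opCoeff v (P * Q) =
      ∑ p ∈ Finset.HasAntidiagonal.antidiagonal v, opCoeff p.1 P * opCoeff p.2 Q := by
  ext1 n
  simp only [coeff_opCoeff, PowerSeries.coeff_mul, map_sum, Polynomial.finsetSum_coeff,
    Polynomial.coeff_mul]
  rw [Finset.sum_comm]

/-- The derivative of a formal operator with respect to the variable `D`. -/
noncomputable def opDeriv : Derivation ℂ (FormalOperator N) (FormalOperator N) :=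
  Derivation.mk'
    { toFun := fun Q : FormalOperator N => PowerSeries.mk fun n => Polynomial.derivative (PowerSeries.coeff n Q)
      map_add' := fun P Q => by
        ext1 n
        simp only [PowerSeries.coeff_mk, map_add]
      map_smul' := fun c P => by
        ext1 n
        simp only [PowerSeries.coeff_mk, PowerSeries.coeff_smul, Polynomial.derivative_smul,
          RingHom.id_apply] }
    (fun P Q => by
      ext1 n
      simp only [LinearMap.coe_mk, AddHom.coe_mk, smul_eq_mul, map_add, PowerSeries.coeff_mk,
        PowerSeries.coeff_mul, Polynomial.derivative_sum, Polynomial.derivative_mul]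
      rw [← Finset.Nat.sum_antidiagonal_swap (n := n)
        (f := fun p => PowerSeries.coeff p.1 Q * _), ← Finset.sum_add_distrib]
      refine Finset.sum_congr rfl fun p _ => ?_
      rw [Prod.fst_swap, Prod.snd_swap, add_comm, mul_comm (PowerSeries.coeff p.2 Q)])

theorem coeff_opDeriv (n : ℕ) (Q : FormalOperator N) :
    PowerSeries.coeff n (opDeriv Q) = Polynomial.derivative (PowerSeries.coeff n Q) := by
  change PowerSeries.coeff n (PowerSeries.mk fun n => Polynomial.derivative (PowerSeries.coeff n Q)) = _
  rw [PowerSeries.coeff_mk]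

theorem opCoeff_opDeriv (v : ℕ) (Q : FormalOperator N) :
    opCoeff v (opDeriv Q) = ((v + 1 : ℕ) : ℂ) • opCoeff (v + 1) Q := by
  ext1 n
  rw [coeff_opCoeff, coeff_opDeriv, Polynomial.coeff_derivative, Nat.cast_smul_eq_nsmul, map_nsmul,
    coeff_opCoeff, nsmul_eq_mul, mul_comm]
  push_cast
  rfl

theorem coeff_pow_eq_zero_of_lt {P : FormalOperator N}
    (hP : PowerSeries.constantCoeff P = 0) {n k : ℕ} (h : n < k) :
    PowerSeries.coeff n (P ^ k) = 0 :=
  PowerSeries.X_pow_dvd_iff.mp (pow_dvd_pow_of_dvd (PowerSeries.X_dvd_iff.mpr hP) k) n h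

/-- As `P` is divisible by `ħ`, powers beyond the `n`-th do not reach `ħⁿ`, and the exponential may
be truncated anywhere above. -/
theorem coeff_expOperator {P : FormalOperator N} (hP : PowerSeries.constantCoeff P = 0)
    {n M : ℕ} (h : n < M) :
    PowerSeries.coeff n (expOperator P) =
      PowerSeries.coeff n (∑ k ∈ Finset.range M, (1 / (k.factorial : ℂ)) • P ^ k) := by
  have hs : PowerSeries.HasSubst P := PowerSeries.HasSubst.of_constantCoeff_zero' hP
  rw [expOperator, PowerSeries.coeff_subst' hs,
    finsum_eq_sum_of_support_subset (s := Finset.range M), map_sum]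
  · refine Finset.sum_congr rfl fun k _ => ?_
    rw [PowerSeries.coeff_smul, PowerSeries.coeff_exp]
    simp
  · intro k hk
    rw [Function.mem_support] at hk
    rw [Finset.coe_range, Set.mem_Iio]
    by_contra hkM
    apply hk
    have h0 : PowerSeries.coeff n (P ^ k) = 0 := coeff_pow_eq_zero_of_lt hP (by omega)
    have h1 := congrArg (PowerSeries.coeff k (PowerSeries.exp ℂ) • ·) h0
    exact h1.trans (smul_zero _)

theorem opDeriv_expOperator {P : FormalOperator N} (hP : PowerSeries.constantCoeff P = 0) :
    opDeriv (expOperator P) = opDeriv P * expOperator P := by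
  ext1 n
  -- Truncation at `n + 2` terms: the derivative kills the constant term and leaves the `n + 1`
  -- terms needed on the right.
  rw [coeff_opDeriv, coeff_expOperator hP (Nat.lt_succ_of_lt (Nat.lt_succ_self n)),
    ← coeff_opDeriv, map_sum, Finset.sum_range_succ']
  have h0 : opDeriv ((1 / (Nat.factorial 0 : ℂ)) • P ^ 0) = 0 := by
    rw [pow_zero, Derivation.map_smul, Derivation.map_one_eq_zero, smul_zero]
  have h1 : ∀ k, opDeriv ((1 / ((k + 1).factorial : ℂ)) • P ^ (k + 1)) =
      opDeriv P * ((1 / (k.factorial : ℂ)) • P ^ k) := by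
    intro k
    rw [Derivation.map_smul, Derivation.leibniz_pow, Nat.add_sub_cancel, smul_eq_mul,
      ← Nat.cast_smul_eq_nsmul ℂ, smul_smul, mul_smul_comm, mul_comm (P ^ k)]
    congr 1
    rw [Nat.factorial_succ, Nat.cast_mul]
    have : ((k + 1 : ℕ) : ℂ) ≠ 0 := Nat.cast_ne_zero.mpr (Nat.succ_ne_zero k)
    field_simp
  rw [h0, add_zero, Finset.sum_congr rfl fun k _ => h1 k, ← Finset.mul_sum, PowerSeries.coeff_mul,
    PowerSeries.coeff_mul]
  refine Finset.sum_congr rfl fun p hp => ?_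
  rw [Finset.HasAntidiagonal.mem_antidiagonal] at hp
  rw [coeff_expOperator hP (show p.2 < n + 1 by omega)]

theorem opCoeff_zero_expOperator {P : FormalOperator N} (hP : PowerSeries.constantCoeff P = 0)
    (hP0 : opCoeff 0 P = 0) : opCoeff 0 (expOperator P) = 1 := by
  ext1 n
  rw [coeff_opCoeff, coeff_expOperator hP (Nat.lt_succ_self n), ← coeff_opCoeff, map_sum,
    Finset.sum_range_succ']
  have h1 : ∀ k, opCoeff 0 ((1 / ((k + 1).factorial : ℂ)) • P ^ (k + 1)) = 0 := by
    intro k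
    rw [map_smul, pow_succ, opCoeff_mul]
    simp [hP0]
  rw [Finset.sum_congr rfl fun k _ => h1 k, Finset.sum_const_zero, zero_add, pow_zero, map_smul]
  have h2 : opCoeff 0 (1 : FormalOperator N) = 1 := by
    ext1 n
    rw [coeff_opCoeff, PowerSeries.coeff_one, PowerSeries.coeff_one]
    split_ifs <;> simp
  rw [h2]
  simp

end OpCoeff

/-! ### The differential equation of the generating functions -/

section GeneratingFunctions

variable {S : Type} [CommRing S] [Algebra ℂ S]

/-- A linear differential equation determines a formal power series from its constant term: the
equation fixes `n + 1` times the next coefficient, and `n + 1` is invertible over `ℂ`. -/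
theorem eq_of_derivative_eq_mul {G Y Z : PowerSeries S}
    (hY : PowerSeries.derivative S Y = G * Y) (hZ : PowerSeries.derivative S Z = G * Z)
    (h0 : PowerSeries.coeff 0 Y = PowerSeries.coeff 0 Z) : Y = Z := by
  ext n
  induction n using Nat.strong_induction_on with
  | _ n ih =>
    cases n with
    | zero => exact h0
    | succ n =>
      have h1 := congrArg (PowerSeries.coeff n) hY
      have h2 := congrArg (PowerSeries.coeff n) hZ
      rw [PowerSeries.coeff_derivative, PowerSeries.coeff_mul] at h1 h2
      have h3 : PowerSeries.coeff (n + 1) Y * (n + 1) = PowerSeries.coeff (n + 1) Z * (n + 1) := by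
        rw [h1, h2]
        refine Finset.sum_congr rfl fun p hp => ?_
        rw [Finset.HasAntidiagonal.mem_antidiagonal] at hp
        rw [ih p.2 (by omega)]
      have h4 : ((n + 1 : ℕ) : ℂ) • PowerSeries.coeff (n + 1) Y =
          ((n + 1 : ℕ) : ℂ) • PowerSeries.coeff (n + 1) Z := by
        rw [Nat.cast_smul_eq_nsmul, Nat.cast_smul_eq_nsmul, nsmul_eq_mul, nsmul_eq_mul, mul_comm,
          mul_comm _ (PowerSeries.coeff (n + 1) Z)]
        exact_mod_cast h3
      have hne : ((n + 1 : ℕ) : ℂ) ≠ 0 := Nat.cast_ne_zero.mpr (Nat.succ_ne_zero n)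
      have h5 := congrArg ((((n + 1 : ℕ) : ℂ))⁻¹ • ·) h4
      simpa only [inv_smul_smul₀ hne] using h5

theorem derivative_mul (Y Z : PowerSeries S) :
    PowerSeries.derivative S (Y * Z) =
      PowerSeries.derivative S Y * Z + Y * PowerSeries.derivative S Z := by
  rw [Derivation.leibniz, smul_eq_mul, smul_eq_mul, add_comm, mul_comm Z]

theorem succ_smul_one_div_factorial (n : ℕ) (x : S) :
    ((1 / ((n + 1).factorial : ℂ)) • x) * ((n : S) + 1) = (1 / (n.factorial : ℂ)) • x := by
  have h : ((n : S) + 1) = algebraMap ℂ S ((n + 1 : ℕ) : ℂ) := by simp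
  rw [h, mul_comm, ← Algebra.smul_def, smul_smul]
  congr 1
  rw [Nat.factorial_succ, Nat.cast_mul]
  have : ((n + 1 : ℕ) : ℂ) ≠ 0 := Nat.cast_ne_zero.mpr (Nat.succ_ne_zero n)
  field_simp

theorem derivative_expSeries (x : S) :
    PowerSeries.derivative S (expSeries x) = PowerSeries.C x * expSeries x := by
  ext n
  rw [PowerSeries.coeff_derivative, PowerSeries.coeff_C_mul, coeff_expSeries, coeff_expSeries,
    succ_smul_one_div_factorial, pow_succ', mul_smul_comm]

end GeneratingFunctions

/-! ### The exponential formula for connected reduced graphs -/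

section ConnectedReduced

variable {N : ℕ}

/-- The first step of a path from `v` to a different vertex is an edge at `v`. -/
theorem LabeledGraph.reduced_of_preconnected {V E : ℕ} {Γ : LabeledGraph V E}
    (h : Γ.toSimpleGraph.Preconnected) (hV : 2 ≤ V) : Γ.Reduced := by
  intro v
  obtain ⟨w, hw⟩ : ∃ w : Fin V, w ≠ v := by
    have : Nontrivial (Fin V) := Fin.nontrivial_iff_two_le.mpr hV
    exact exists_ne v
  rcases Relation.ReflTransGen.cases_head
    ((SimpleGraph.reachable_iff_reflTransGen v w).mp (h v w)) with heq | ⟨u, hu, _⟩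
  · exact absurd heq.symm hw
  · obtain ⟨_, e, he, _⟩ := hu
    exact ⟨e, he⟩

open Classical in
/-- The sum over the connected, reduced, non-empty labeled graphs with `k` vertices. -/
noncomputable def connectedReducedSum (A : FormalSymbol N) (k : ℕ) : FormalSymbol N :=
  hbarSum fun E => ((Complex.I / 2) ^ E / (E.factorial : ℂ)) •
    ∑ Γ : LabeledGraph k E with Γ.IsConnectedReduced, Γ.lam fun _ => A

theorem connectedReducedSum_zero (A : FormalSymbol N) : connectedReducedSum A 0 = 0 := by
  classical
  rw [connectedReducedSum, ← hbarSum_zero]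
  refine hbarSum_congr fun E => ?_
  rw [Finset.filter_false_of_mem fun Γ _ h => absurd h.2.2 (lt_irrefl 0), Finset.sum_empty,
    smul_zero]

theorem isEmpty_labeledGraph_one {E : ℕ} (hE : E ≠ 0) : IsEmpty (LabeledGraph 1 E) := by
  refine ⟨fun Γ => ?_⟩
  have := Γ.src_lt_tgt ⟨0, Nat.pos_of_ne_zero hE⟩
  omega

theorem connectedReducedSum_one (A : FormalSymbol N) : connectedReducedSum A 1 = 0 := by
  classical
  rw [connectedReducedSum, ← hbarSum_zero]
  refine hbarSum_congr fun E => ?_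
  rw [Finset.filter_false_of_mem, Finset.sum_empty, smul_zero]
  intro Γ _ h
  have := h.2.1.card_le
  exact (isEmpty_labeledGraph_one (by omega)).false Γ

theorem connectedLabeledSum_one (A : FormalSymbol N) : connectedLabeledSum A 1 = A := by
  classical
  rw [connectedLabeledSum, hbarSum_eq_zeroth]
  · have : Unique (LabeledGraph 1 0) := inferInstanceAs (Unique (Fin 0 → _))
    rw [Finset.filter_true_of_mem fun Γ _ => SimpleGraph.Preconnected.of_subsingleton,
      Fintype.sum_unique]
    have h := LabeledGraph.smul_lam_eq_evalAt A (default : LabeledGraph 1 0)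
      (φ := fun v => (v : ℕ)) Fin.val_injective
    rw [pow_zero, one_smul, Finset.prod_of_isEmpty, evalAt_one,
      Finset.card_image_of_injective _ Fin.val_injective, Finset.card_univ, Fintype.card_fin,
      pow_one] at h
    rw [h]
    simp
  · intro E hE
    have := isEmpty_labeledGraph_one hE
    rw [Finset.univ_eq_empty, Finset.filter_empty, Finset.sum_empty, smul_zero]

theorem connectedLabeledSum_eq (A : FormalSymbol N) {k : ℕ} (hk : 2 ≤ k) :
    connectedLabeledSum A k = connectedReducedSum A k := by
  classical
  rw [connectedLabeledSum, connectedReducedSum]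
  refine hbarSum_congr fun E => ?_
  congr 2
  ext Γ
  simp only [Finset.mem_filter, Finset.mem_univ, true_and]
  exact ⟨fun h => ⟨h, LabeledGraph.reduced_of_preconnected h hk, by omega⟩, fun h => h.1⟩

/-- The isolated vertex is the only non-empty connected graph that is not reduced. Its contribution
`A` is responsible for derivatives of `f` being taken at `A`. -/
theorem connectedLabeledSum_succ (A : FormalSymbol N) (k : ℕ) :
    connectedLabeledSum A (k + 1) = connectedReducedSum A (k + 1) + if k = 0 then A else 0 := by
  rcases Nat.eq_zero_or_pos k with rfl | hk
  · rw [zero_add, connectedLabeledSum_one, connectedReducedSum_one, if_pos rfl, zero_add]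
  · rw [connectedLabeledSum_eq A (by omega), if_neg hk.ne', add_zero]

variable {rep : ∀ V E : ℕ, UnlabeledGraph V E → LabeledGraph V E}

theorem opCoeff_connectedGraphSum
    (hrep : ∀ (V E : ℕ) (G : UnlabeledGraph V E),
      (Quotient.mk'' (rep V E G) : UnlabeledGraph V E) = G) (A : FormalSymbol N) (v : ℕ) :
    opCoeff v (connectedGraphSum rep A) =
      (1 / (v.factorial : ℂ)) • connectedReducedSum A v := by
  classical
  rw [connectedGraphSum, opCoeff_hbarSum, connectedReducedSum, ← hbarSum_smul]
  refine hbarSum_congr fun E => ?_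
  simp only [map_sum]
  have h1 : ∀ (V : ℕ) (G : UnlabeledGraph V E), opCoeff v
      (if (rep V E G).IsConnectedReduced then
        ((Complex.I / 2) ^ E * (((rep V E G).orderSum : ℂ) / ((rep V E G).symOrder : ℂ)) /
            (V.factorial : ℂ)) •
          (PowerSeries.map Polynomial.C ((rep V E G).lam fun _ => A) *
            PowerSeries.C (Polynomial.X ^ V))
      else 0) =
      if v = V then ((Complex.I / 2) ^ E / (V.factorial : ℂ)) •
        (if (rep V E G).IsConnectedReduced then
          (((rep V E G).orderSum : ℂ) / ((rep V E G).symOrder : ℂ)) •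
            (rep V E G).lam (fun _ => A) else 0) else 0 := by
    intro V G
    split_ifs with h2 h3 h3
    · rw [map_smul, opCoeff_map_C_mul, if_pos h3, smul_smul]
      congr 1
      ring
    · rw [map_smul, opCoeff_map_C_mul, if_neg h3, smul_zero]
    · rw [map_zero, smul_zero]
    · rw [map_zero]
  have h2 : ∀ V : ℕ, (∑ G : UnlabeledGraph V E, opCoeff v
      (if (rep V E G).IsConnectedReduced then
        ((Complex.I / 2) ^ E * (((rep V E G).orderSum : ℂ) / ((rep V E G).symOrder : ℂ)) /
            (V.factorial : ℂ)) •
          (PowerSeries.map Polynomial.C ((rep V E G).lam fun _ => A) *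
            PowerSeries.C (Polynomial.X ^ V))
      else 0)) =
      if v = V then ((Complex.I / 2) ^ E / (V.factorial : ℂ)) • (1 / (E.factorial : ℂ)) •
        ∑ Γ : LabeledGraph V E with Γ.IsConnectedReduced, Γ.lam fun _ => A else 0 := by
    intro V
    simp only [h1]
    split_ifs with h
    · rw [← Finset.smul_sum, LabeledGraph.sum_unlabeledGraph_eq A V E (rep V E) (hrep V E)]
    · rw [Finset.sum_const_zero]
  simp only [h2]
  rw [Finset.sum_ite_eq]
  split_ifs with h3
  · rw [smul_smul, smul_smul]
    congr 1
    ring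
  -- The cutoff `V ≤ 2E` loses nothing, since a reduced graph satisfies it.
  · rw [Finset.filter_false_of_mem, Finset.sum_empty, smul_zero, smul_zero]
    intro Γ _ h
    have := h.2.1.card_le
    rw [Finset.mem_range] at h3
    omega

/-- The exponential formula: the exponential of the sum over connected graphs generates the Moyal
powers. -/
theorem sum_opCoeff_expOperator
    (hrep : ∀ (V E : ℕ) (G : UnlabeledGraph V E),
      (Quotient.mk'' (rep V E G) : UnlabeledGraph V E) = G) (A : FormalSymbol N) (n : ℕ) :
    ∑ p ∈ Finset.HasAntidiagonal.antidiagonal n,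
      opCoeff p.1 (expOperator (connectedGraphSum rep A)) *
        (1 / (p.2.factorial : ℂ)) • A ^ p.2 = (1 / (n.factorial : ℂ)) • moyalPow A n := by
  have hP := constantCoeff_connectedGraphSum rep A
  set P := connectedGraphSum rep A with hPdef
  have hcoeff : ∀ v, opCoeff v P = (1 / (v.factorial : ℂ)) • connectedReducedSum A v :=
    opCoeff_connectedGraphSum hrep A
  -- Generating functions in an auxiliary variable `t`, which takes the place of `D`: `p` for the
  -- exponent, `q` for its exponential, `Z` for the Moyal powers.
  set p : PowerSeries (FormalSymbol N) := PowerSeries.mk fun v => opCoeff v P with hp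
  set q : PowerSeries (FormalSymbol N) := PowerSeries.mk fun v => opCoeff v (expOperator P) with hq
  set Z : PowerSeries (FormalSymbol N) :=
    PowerSeries.mk fun n => (1 / (n.factorial : ℂ)) • moyalPow A n with hZ
  have hq' : PowerSeries.derivative (FormalSymbol N) q =
      PowerSeries.derivative (FormalSymbol N) p * q := by
    ext1 v
    have h := congrArg (opCoeff v) (opDeriv_expOperator hP)
    rw [opCoeff_opDeriv, opCoeff_mul] at h
    rw [PowerSeries.coeff_derivative, PowerSeries.coeff_mul, hq, PowerSeries.coeff_mk]
    rw [Nat.cast_smul_eq_nsmul, nsmul_eq_mul, mul_comm] at h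
    push_cast at h
    rw [h]
    refine Finset.sum_congr rfl fun i _ => ?_
    rw [opCoeff_opDeriv, PowerSeries.coeff_derivative, hp, PowerSeries.coeff_mk,
      PowerSeries.coeff_mk, Nat.cast_smul_eq_nsmul, nsmul_eq_mul, mul_comm ((i.1 + 1 : ℕ) : FormalSymbol N)]
    push_cast
    rfl
  -- This is the recursion for Moyal powers; the summand `A` is the one-vertex graph.
  have hZ' : PowerSeries.derivative (FormalSymbol N) Z =
      (PowerSeries.derivative (FormalSymbol N) p + PowerSeries.C A) * Z := by
    ext1 n
    rw [PowerSeries.coeff_derivative, PowerSeries.coeff_mul, hZ, PowerSeries.coeff_mk,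
      succ_smul_one_div_factorial,
      moyalPow_succ_eq_sum A (connectedLabeledSum A) (evalSeries_connectedSeries A),
      Finset.Nat.sum_antidiagonal_eq_sum_range_succ_mk, Finset.smul_sum]
    refine Finset.sum_congr rfl fun k hk => ?_
    rw [Finset.mem_range] at hk
    have h1 : PowerSeries.coeff k (PowerSeries.derivative (FormalSymbol N) p + PowerSeries.C A) =
        (1 / (k.factorial : ℂ)) • connectedLabeledSum A (k + 1) := by
      rw [map_add, PowerSeries.coeff_derivative, hp, PowerSeries.coeff_mk, hcoeff,
        succ_smul_one_div_factorial, connectedLabeledSum_succ, smul_add, PowerSeries.coeff_C]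
      congr 1
      split_ifs with h
      · simp [h]
      · simp
    rw [h1, PowerSeries.coeff_mk, smul_mul_smul_comm, smul_smul]
    congr 1
    have h2 := Nat.choose_mul_factorial_mul_factorial (show k ≤ n by omega)
    have h3 : (n.factorial : ℂ) ≠ 0 := Nat.cast_ne_zero.mpr (Nat.factorial_ne_zero _)
    have h4 : (k.factorial : ℂ) ≠ 0 := Nat.cast_ne_zero.mpr (Nat.factorial_ne_zero _)
    have h5 : ((n - k).factorial : ℂ) ≠ 0 := Nat.cast_ne_zero.mpr (Nat.factorial_ne_zero _)
    field_simp
    exact_mod_cast h2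
  have hY' : PowerSeries.derivative (FormalSymbol N) (q * expSeries A) =
      (PowerSeries.derivative (FormalSymbol N) p + PowerSeries.C A) * (q * expSeries A) := by
    rw [derivative_mul, derivative_expSeries, hq']
    ring
  have hfin : q * expSeries A = Z := by
    refine eq_of_derivative_eq_mul hY' hZ' ?_
    -- The exponent has no term without `D`, so both solutions start with `1`.
    have h0 : opCoeff 0 P = 0 := by
      rw [hcoeff, connectedReducedSum_zero, smul_zero]
    rw [PowerSeries.coeff_mul, Finset.Nat.antidiagonal_zero, Finset.sum_singleton, hq, hZ,
      PowerSeries.coeff_mk, PowerSeries.coeff_mk, opCoeff_zero_expOperator hP h0, coeff_expSeries]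
    simp [moyalPow]
  have h := congrArg (PowerSeries.coeff n) hfin
  rw [PowerSeries.coeff_mul, hZ, PowerSeries.coeff_mk] at h
  rw [← h]
  refine Finset.sum_congr rfl fun i _ => ?_
  rw [hq, PowerSeries.coeff_mk, coeff_expSeries]

end ConnectedReduced

/-! ### Composition of functions with symbols -/

/-- The value of a smooth function at a point. -/
noncomputable def evalPt {F : Type} [NormedAddCommGroup F] [NormedSpace ℝ F] (z : F) :
    smoothFunctions F →ₐ[ℂ] ℂ :=
  (Pi.evalAlgHom ℂ (fun _ : F => ℂ) z).comp (smoothFunctions F).val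

theorem smoothFunctions_ext {F : Type} [NormedAddCommGroup F] [NormedSpace ℝ F]
    {f g : smoothFunctions F} (h : ∀ z, evalPt z f = evalPt z g) : f = g :=
  Subtype.ext (funext h)

section DerivFn

theorem derivFn_mul (f g : smoothFunctions ℝ) :
    derivFn (f * g) = derivFn f * g + f * derivFn g := dirDeriv_mul _ _ _

/-- The derivative as a linear map. -/
noncomputable def derivLM : smoothFunctions ℝ →ₗ[ℂ] smoothFunctions ℝ := dirDerivLM (1 : ℝ)

theorem iterate_derivFn (v : ℕ) (f : smoothFunctions ℝ) : derivFn^[v] f = (derivLM ^ v) f := by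
  rw [Module.End.pow_apply]
  rfl

/-- The derivative as a derivation. -/
noncomputable def derivD : Derivation ℂ (smoothFunctions ℝ) (smoothFunctions ℝ) :=
  Derivation.mk' derivLM fun f g => by
    refine (derivFn_mul f g).trans ?_
    rw [add_comm, mul_comm (derivFn f)]
    rfl

theorem derivFn_coordFn : derivFn coordFn = 1 := by
  refine smoothFunctions_ext fun y => ?_
  change fderiv ℝ (fun y : ℝ => (y : ℂ)) y 1 = 1
  have h : HasFDerivAt (fun y : ℝ => (y : ℂ)) Complex.ofRealCLM y := Complex.ofRealCLM.hasFDerivAt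
  rw [h.fderiv]
  simp

theorem derivFn_coordFn_pow (n : ℕ) : derivFn (coordFn ^ n) = (n : ℂ) • coordFn ^ (n - 1) := by
  have h := Derivation.leibniz_pow derivD coordFn n
  have h1 : derivD coordFn = 1 := derivFn_coordFn
  rw [h1] at h
  refine h.trans ?_
  rw [smul_eq_mul, mul_one, Nat.cast_smul_eq_nsmul]

theorem iterate_derivFn_coordFn_pow (v n : ℕ) :
    derivFn^[v] (coordFn ^ n) = (n.descFactorial v : ℂ) • coordFn ^ (n - v) := by
  induction v with
  | zero => simp
  | succ v ih =>
    rw [Function.iterate_succ_apply', ih]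
    refine (dirDeriv_smul _ _ _).trans ?_
    change _ • derivFn _ = _
    rw [derivFn_coordFn_pow, smul_smul, Nat.descFactorial_succ, Nat.sub_sub, mul_comm]
    push_cast
    rfl

/-- By the product rule each derivative uses up only one factor `y - a`. -/
theorem evalPt_iterate_derivFn_eq_zero (a : ℝ) {j M : ℕ} (hj : j < M) (h : smoothFunctions ℝ) :
    evalPt a (derivFn^[j] ((coordFn - algebraMap ℂ _ (a : ℂ)) ^ M * h)) = 0 := by
  induction j generalizing M h with
  | zero =>
    have h0 : evalPt a (coordFn - algebraMap ℂ _ (a : ℂ)) = 0 := by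
      rw [map_sub, AlgHom.commutes]
      exact sub_self (a : ℂ)
    rw [Function.iterate_zero_apply, map_mul, map_pow, h0, zero_pow (by omega), zero_mul]
  | succ j ih =>
    obtain ⟨M, rfl⟩ : ∃ M', M = M' + 1 := ⟨M - 1, by omega⟩
    have h1 : derivD (coordFn - algebraMap ℂ _ (a : ℂ)) = 1 := by
      rw [map_sub, Derivation.map_algebraMap, sub_zero]
      exact derivFn_coordFn
    have h2 : derivFn ((coordFn - algebraMap ℂ _ (a : ℂ)) ^ (M + 1) * h) =
        (coordFn - algebraMap ℂ _ (a : ℂ)) ^ M *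
          (((M + 1 : ℕ) : smoothFunctions ℝ) * h +
            (coordFn - algebraMap ℂ _ (a : ℂ)) * derivFn h) := by
      rw [derivFn_mul]
      have h3 := Derivation.leibniz_pow derivD (coordFn - algebraMap ℂ _ (a : ℂ)) (M + 1)
      rw [h1, smul_eq_mul, mul_one, Nat.add_sub_cancel, nsmul_eq_mul] at h3
      rw [show derivFn ((coordFn - algebraMap ℂ _ (a : ℂ)) ^ (M + 1)) = _ from h3]
      ring
    rw [Function.iterate_succ_apply, h2]
    exact ih (by omega) _

end DerivFn

section CompSymbol

variable {N : ℕ}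

theorem evalPt_compClassical (z : PhaseSpace N) (f : smoothFunctions ℝ) (a : ClassicalSymbol N) :
    evalPt z (compClassical f a) = evalPt (evalPt z a).re f := rfl

theorem compClassical_add (f g : smoothFunctions ℝ) (a : ClassicalSymbol N) :
    compClassical (f + g) a = compClassical f a + compClassical g a := rfl

theorem compClassical_smul (c : ℂ) (f : smoothFunctions ℝ) (a : ClassicalSymbol N) :
    compClassical (c • f) a = c • compClassical f a := rfl

/-- Here the reality of `A₀` enters, since `compClassical` composes with the real part. -/
theorem compClassical_coordFn_pow (m : ℕ) {a : ClassicalSymbol N}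
    (ha : ∀ z, (evalPt z a).im = 0) : compClassical (coordFn ^ m) a = a ^ m := by
  refine smoothFunctions_ext fun z => ?_
  rw [evalPt_compClassical, map_pow, map_pow]
  congr 1
  change (((evalPt z a).re : ℝ) : ℂ) = _
  exact Complex.ext rfl (by rw [Complex.ofReal_im, ha])

/-- `f(A)` as a linear map of `f`. -/
noncomputable def compSymbolLM (A : FormalSymbol N) :
    smoothFunctions ℝ →ₗ[ℂ] FormalSymbol N where
  toFun f := compSymbol f A
  map_add' f g := by
    ext1 n
    simp only [compSymbol, PowerSeries.coeff_mk, map_add, iterate_derivFn, compClassical_add,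
      add_mul, smul_add, Finset.sum_add_distrib]
  map_smul' c f := by
    ext1 n
    simp only [compSymbol, PowerSeries.coeff_mk, PowerSeries.coeff_smul, map_smul,
      iterate_derivFn, compClassical_smul, RingHom.id_apply, Finset.smul_sum, smul_mul_assoc]
    exact Finset.sum_congr rfl fun j _ => smul_comm _ _ _

theorem compSymbolLM_apply (A : FormalSymbol N) (f : smoothFunctions ℝ) :
    compSymbolLM A f = compSymbol f A := rfl

theorem coeff_compSymbol (f : smoothFunctions ℝ) (A : FormalSymbol N) (n : ℕ) :
    PowerSeries.coeff n (compSymbol f A) = ∑ j ∈ Finset.range (n + 1),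
      ((1 : ℂ) / (j.factorial : ℂ)) •
        (compClassical (derivFn^[j] f) (PowerSeries.constantCoeff A) *
          PowerSeries.coeff n ((A - PowerSeries.C (PowerSeries.constantCoeff A)) ^ j)) :=
  PowerSeries.coeff_mk _ _

theorem coeff_sub_constantCoeff_pow {R : Type*} [CommRing R] (A : PowerSeries R) {n j : ℕ}
    (h : n < j) :
    PowerSeries.coeff n ((A - PowerSeries.C (PowerSeries.constantCoeff A)) ^ j) = 0 := by
  refine PowerSeries.X_pow_dvd_iff.mp (pow_dvd_pow_of_dvd (PowerSeries.X_dvd_iff.mpr ?_) j) n h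
  rw [map_sub, PowerSeries.constantCoeff_C, sub_self]

/-- For a power, Taylor's formula around `A₀` is the binomial theorem for `A₀ + (A - A₀)`. -/
theorem compSymbol_coordFn_pow {A : FormalSymbol N}
    (hA : ∀ z, (evalPt z (PowerSeries.constantCoeff A)).im = 0) (m : ℕ) :
    compSymbol (coordFn ^ m) A = A ^ m := by
  ext1 n
  set a := PowerSeries.constantCoeff A with ha
  set B := A - PowerSeries.C a with hB
  have hAB : A ^ m = (B + PowerSeries.C a) ^ m := by rw [hB, sub_add_cancel]
  have hterm : ∀ j, ((1 : ℂ) / (j.factorial : ℂ)) •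
      (compClassical (derivFn^[j] (coordFn ^ m)) a * PowerSeries.coeff n (B ^ j)) =
      (m.choose j : ℂ) • (a ^ (m - j) * PowerSeries.coeff n (B ^ j)) := by
    intro j
    rw [iterate_derivFn_coordFn_pow, compClassical_smul, compClassical_coordFn_pow _ hA,
      smul_mul_assoc, smul_smul]
    congr 1
    rw [Nat.descFactorial_eq_factorial_mul_choose, Nat.cast_mul]
    have : (j.factorial : ℂ) ≠ 0 := Nat.cast_ne_zero.mpr (Nat.factorial_ne_zero _)
    field_simp
  have hterm' : ∀ j, PowerSeries.coeff n (B ^ j * PowerSeries.C a ^ (m - j) *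
      ((m.choose j : ℕ) : FormalSymbol N)) =
      (m.choose j : ℂ) • (a ^ (m - j) * PowerSeries.coeff n (B ^ j)) := by
    intro j
    rw [mul_comm, ← nsmul_eq_mul, map_nsmul, ← map_pow, PowerSeries.coeff_mul_C, mul_comm,
      Nat.cast_smul_eq_nsmul]
  rw [coeff_compSymbol, hAB, add_pow, map_sum]
  simp only [← ha, ← hB, hterm, hterm']
  -- The Taylor sum stops at `n`, the binomial sum at `m`; both extend by zeros to the common range.
  refine (Finset.sum_subset (Finset.range_subset_range.mpr (show n + 1 ≤ n + m + 1 by omega))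
    fun j _ hj => ?_).trans
    (Finset.sum_subset (Finset.range_subset_range.mpr (show m + 1 ≤ n + m + 1 by omega))
      fun j _ hj => ?_).symm
  · rw [Finset.mem_range] at hj
    rw [hB, ha, coeff_sub_constantCoeff_pow A (by omega), mul_zero, smul_zero]
  · rw [Finset.mem_range] at hj
    rw [Nat.choose_eq_zero_of_lt (by omega), Nat.cast_zero, zero_smul]

theorem evalPt_coeff_compSymbol_eq_zero {A : FormalSymbol N} (z : PhaseSpace N)
    {f : smoothFunctions ℝ} {n : ℕ}
    (hf : ∀ j ≤ n, evalPt (evalPt z (PowerSeries.constantCoeff A)).re (derivFn^[j] f) = 0) :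
    evalPt z (PowerSeries.coeff n (compSymbol f A)) = 0 := by
  rw [coeff_compSymbol, map_sum]
  refine Finset.sum_eq_zero fun j hj => ?_
  rw [Finset.mem_range] at hj
  rw [map_smul, map_mul, evalPt_compClassical, hf j (by omega), zero_mul, smul_zero]

end CompSymbol

/-! ### Formal operators acting on functions -/

section ApplyOperator

variable {N : ℕ}

/-- `P f(A)` as a linear map of `f`. -/
noncomputable def applyOperatorLM (P : FormalOperator N) (A : FormalSymbol N) :
    smoothFunctions ℝ →ₗ[ℂ] FormalSymbol N where
  toFun f := applyOperator P f A
  map_add' f g := by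
    simp only [applyOperator, Polynomial.sum, iterate_derivFn, ← compSymbolLM_apply, map_add,
      mul_add, Finset.sum_add_distrib, hbarSum_add]
  map_smul' c f := by
    simp only [applyOperator, Polynomial.sum, iterate_derivFn, ← compSymbolLM_apply, map_smul,
      mul_smul_comm, ← Finset.smul_sum, hbarSum_smul, RingHom.id_apply]

theorem hbarSum_C_coeff {R : Type} [Semiring R] (L : PowerSeries R) :
    (hbarSum fun n => PowerSeries.C (PowerSeries.coeff n L)) = L := by
  ext n
  rw [coeff_hbarSum, Finset.sum_eq_single (n, 0)]
  · simp
  · rintro ⟨i, j⟩ hij hne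
    rw [Finset.HasAntidiagonal.mem_antidiagonal] at hij
    have : j ≠ 0 := by
      rintro rfl
      exact hne (by rw [← hij, add_zero])
    rw [PowerSeries.coeff_C, if_neg this]
  · simp

theorem applyOperator_coordFn_pow (P : FormalOperator N) {A : FormalSymbol N}
    (hA : ∀ z, (evalPt z (PowerSeries.constantCoeff A)).im = 0) (n : ℕ) :
    applyOperator P (coordFn ^ n) A =
      ∑ v ∈ Finset.range (n + 1), opCoeff v P * (n.descFactorial v : ℂ) • A ^ (n - v) := by
  have hG : ∀ v, compSymbol (derivFn^[v] (coordFn ^ n)) A =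
      (n.descFactorial v : ℂ) • A ^ (n - v) := fun v => by
    rw [iterate_derivFn_coordFn_pow, ← compSymbolLM_apply, map_smul, compSymbolLM_apply,
      compSymbol_coordFn_pow hA]
  have h1 : ∀ p : Polynomial (ClassicalSymbol N),
      (p.sum fun v a => PowerSeries.C a * compSymbol (derivFn^[v] (coordFn ^ n)) A) =
      ∑ v ∈ Finset.range (n + 1),
        PowerSeries.C (p.coeff v) * (n.descFactorial v : ℂ) • A ^ (n - v) := by
    intro p
    -- The range covers both the degree of `p` and all `v ≤ n`; beyond `n` the derivatives of `yⁿ`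
    -- vanish.
    rw [Polynomial.sum_over_range' p (fun v => by rw [map_zero, zero_mul]) (n + 1 + p.natDegree + 1)
      (by omega)]
    simp only [hG]
    refine (Finset.sum_subset (Finset.range_subset_range.mpr (by omega)) fun v _ hv => ?_).symm
    rw [Finset.mem_range] at hv
    rw [Nat.descFactorial_eq_zero_iff_lt.mpr (by omega), Nat.cast_zero, zero_smul, mul_zero]
  rw [applyOperator]
  simp only [h1]
  rw [hbarSum_finset_sum]
  refine Finset.sum_congr rfl fun v _ => ?_
  rw [← hbarSum_mul]
  congr 1
  conv_rhs => rw [← hbarSum_C_coeff (opCoeff v P)]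
  simp only [coeff_opCoeff]

/-- Since `Dᵛ yⁿ = n!/(n-v)! · y^(n-v)`, the left side is `n!` times the coefficient of `tⁿ` in the
exponential formula. -/
theorem applyOperator_expOperator_coordFn_pow
    {rep : ∀ V E : ℕ, UnlabeledGraph V E → LabeledGraph V E}
    (hrep : ∀ (V E : ℕ) (G : UnlabeledGraph V E),
      (Quotient.mk'' (rep V E G) : UnlabeledGraph V E) = G)
    {A : FormalSymbol N} (hA : ∀ z, (evalPt z (PowerSeries.constantCoeff A)).im = 0) (n : ℕ) :
    applyOperator (expOperator (connectedGraphSum rep A)) (coordFn ^ n) A = moyalPow A n := by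
  have h := congrArg ((n.factorial : ℂ) • ·) (sum_opCoeff_expOperator hrep A n)
  have hn : (n.factorial : ℂ) ≠ 0 := Nat.cast_ne_zero.mpr (Nat.factorial_ne_zero _)
  simp only [smul_smul, mul_one_div_cancel hn, one_smul, Finset.smul_sum] at h
  rw [applyOperator_coordFn_pow _ hA, ← h, Finset.Nat.sum_antidiagonal_eq_sum_range_succ_mk]
  refine Finset.sum_congr rfl fun v hv => ?_
  rw [Finset.mem_range] at hv
  rw [mul_smul_comm, mul_smul_comm, smul_smul]
  congr 1
  have h2 := Nat.factorial_mul_descFactorial (show v ≤ n by omega)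
  have h3 : ((n - v).factorial : ℂ) ≠ 0 := Nat.cast_ne_zero.mpr (Nat.factorial_ne_zero _)
  rw [← h2, Nat.cast_mul]
  field_simp

/-- Each coefficient of `P f(A)` at a point depends on a finite jet of `f` only. -/
theorem exists_evalPt_coeff_applyOperator_eq_zero (P : FormalOperator N) (A : FormalSymbol N)
    (z : PhaseSpace N) (n : ℕ) :
    ∃ M : ℕ, ∀ f : smoothFunctions ℝ,
      (∀ j < M, evalPt (evalPt z (PowerSeries.constantCoeff A)).re (derivFn^[j] f) = 0) →
      evalPt z (PowerSeries.coeff n (applyOperator P f A)) = 0 := by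
  -- At most the maximal degree in `D` up to order `ħⁿ`, plus `n` further derivatives from the
  -- Taylor expansion of `f⁽ᵛ⁾(A)`.
  refine ⟨(Finset.range (n + 1)).sup (fun i => (PowerSeries.coeff i P).natDegree) + n + 1,
    fun f hf => ?_⟩
  rw [applyOperator, coeff_hbarSum, map_sum]
  refine Finset.sum_eq_zero fun p hp => ?_
  rw [Finset.HasAntidiagonal.mem_antidiagonal] at hp
  rw [Polynomial.sum, map_sum, map_sum]
  refine Finset.sum_eq_zero fun v hv => ?_
  rw [PowerSeries.coeff_C_mul, map_mul, evalPt_coeff_compSymbol_eq_zero, mul_zero]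
  intro j hj
  rw [← Function.iterate_add_apply]
  refine hf _ ?_
  have h1 := Polynomial.le_natDegree_of_mem_supp v hv
  have h2 : (PowerSeries.coeff p.1 P).natDegree ≤
      (Finset.range (n + 1)).sup fun i => (PowerSeries.coeff i P).natDegree :=
    Finset.le_sup (f := fun i => (PowerSeries.coeff i P).natDegree)
      (Finset.mem_range.mpr (by omega))
  omega

end ApplyOperator

/-! ### Vanishing orders of Moyal products -/

section Vanishing

variable {N : ℕ}

/-- `C` vanishes to order `w` at `z`, where `ħ` counts twice. -/
def VanishesAt (z : PhaseSpace N) (w : ℕ) (C : FormalSymbol N) : Prop :=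
  ∀ (l : List (CoordIndex N)) (j : ℕ), l.length + 2 * j < w →
    evalPt z (PowerSeries.coeff j (iterPderiv l C)) = 0

theorem VanishesAt.pderivSymbol {z : PhaseSpace N} {w : ℕ} {C : FormalSymbol N}
    (h : VanishesAt z w C) (μ : CoordIndex N) : VanishesAt z (w - 1) (pderivSymbol μ C) := by
  intro l j hlj
  rw [← pderivSymbol_iterPderiv, ← iterPderiv_cons]
  exact h (μ :: l) j (by rw [List.length_cons]; omega)

theorem VanishesAt.mono {z : PhaseSpace N} {w w' : ℕ} {C : FormalSymbol N}
    (h : VanishesAt z w C) (hw : w' ≤ w) : VanishesAt z w' C :=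
  fun l j hlj => h l j (by omega)

theorem pderivSymbol_moyalBracket (μ : CoordIndex N) (k : ℕ) (C D : FormalSymbol N) :
    pderivSymbol μ (moyalBracket k C D) =
      moyalBracket k (pderivSymbol μ C) D + moyalBracket k C (pderivSymbol μ D) := by
  simp only [moyalBracket]
  rw [← pderivD_apply]
  simp only [map_sum, Derivation.map_smul, Derivation.leibniz, pderivD_apply,
    pderivSymbol_iterPderiv, smul_add, Finset.sum_add_distrib, smul_eq_mul]
  rw [add_comm]
  simp only [mul_comm]

theorem pderivSymbol_moyal (μ : CoordIndex N) (C D : FormalSymbol N) :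
    pderivSymbol μ (moyal C D) = moyal (pderivSymbol μ C) D + moyal C (pderivSymbol μ D) := by
  rw [moyal, moyal, moyal, pderivSymbol_hbarSum, ← hbarSum_add]
  refine hbarSum_congr fun k => ?_
  rw [← pderivD_apply, Derivation.map_smul, pderivD_apply, pderivSymbol_moyalBracket, smul_add]

/-- A term with `i` contractions and coefficients of orders `a`, `b` in `ħ` has `i + a + b = j`. The
weights `i + 2a` and `i + 2b` of its factors add up to `2j < p + q`, so one of the factors vanishes.
-/
theorem evalPt_coeff_moyal_eq_zero {z : PhaseSpace N} {p q j : ℕ} {C D : FormalSymbol N}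
    (hC : VanishesAt z p C) (hD : VanishesAt z q D) (hj : 2 * j < p + q) :
    evalPt z (PowerSeries.coeff j (moyal C D)) = 0 := by
  rw [moyal, coeff_hbarSum, map_sum]
  refine Finset.sum_eq_zero fun i hi => ?_
  rw [Finset.HasAntidiagonal.mem_antidiagonal] at hi
  rw [PowerSeries.coeff_smul, map_smul, moyalBracket, map_sum, map_sum,
    Finset.sum_eq_zero fun μ _ => ?_, smul_zero]
  rw [map_sum, map_sum]
  refine Finset.sum_eq_zero fun ν _ => ?_
  rw [PowerSeries.coeff_smul, map_smul, PowerSeries.coeff_mul, map_sum,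
    Finset.sum_eq_zero fun a ha => ?_, smul_zero]
  rw [Finset.HasAntidiagonal.mem_antidiagonal] at ha
  rw [map_mul]
  rcases (by omega : i.1 + 2 * a.1 < p ∨ i.1 + 2 * a.2 < q) with h | h
  · rw [hC _ _ (by rwa [List.length_ofFn]), zero_mul]
  · rw [hD _ _ (by rwa [List.length_ofFn]), mul_zero]

theorem VanishesAt.moyal {z : PhaseSpace N} {p q : ℕ} {C D : FormalSymbol N}
    (hC : VanishesAt z p C) (hD : VanishesAt z q D) : VanishesAt z (p + q) (moyal C D) := by
  intro l
  -- The last entry of the list is the innermost derivative. Moving it into the factors by the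
  -- Leibniz rule lowers the order of one of them by at most one.
  induction l using List.reverseRecOn generalizing p q C D with
  | nil =>
    intro j hj
    rw [List.length_nil, zero_add] at hj
    exact evalPt_coeff_moyal_eq_zero hC hD hj
  | append_singleton l μ ih =>
    intro j hj
    rw [List.length_append, List.length_singleton] at hj
    have h1 := ih (hC.pderivSymbol μ) hD j
    have h2 := ih hC (hD.pderivSymbol μ) j
    rw [iterPderiv_append, iterPderiv_cons, iterPderiv_nil, pderivSymbol_moyal,
      ← iterPderivLM_apply, map_add, iterPderivLM_apply, iterPderivLM_apply, map_add, map_add,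
      h1 (by omega), h2 (by omega), add_zero]

end Vanishing

/-! ### The functional calculus -/

section FunctionalCalculus

variable {N : ℕ} {𝒜 : Subalgebra ℂ (smoothFunctions ℝ)}

noncomputable instance (𝒜 : Subalgebra ℂ (smoothFunctions ℝ)) : AddCommGroup 𝒜 :=
  𝒜.toCommRing.toAddCommGroup

/-- The coordinate function as an element of the algebra `𝒜`. -/
noncomputable def IsFunctionAlgebra.coord (h𝒜 : IsFunctionAlgebra 𝒜) : 𝒜 :=
  ⟨coordFn, h𝒜.coord_mem⟩

/-- Taylor's formula with a remainder in `𝒜`: subtract the value of `h` at `a`, divide by `y - a`,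
and repeat. -/
theorem IsFunctionAlgebra.exists_eq_aeval_add (h𝒜 : IsFunctionAlgebra 𝒜) (a : ℝ) (M : ℕ)
    (f : 𝒜) : ∃ (p : Polynomial ℂ) (h : 𝒜),
      f = Polynomial.aeval h𝒜.coord p + (h𝒜.coord - algebraMap ℂ 𝒜 (a : ℂ)) ^ M * h := by
  induction M with
  | zero => exact ⟨0, f, by simp⟩
  | succ M ih =>
    obtain ⟨p, h, hf⟩ := ih
    set c : ℂ := evalPt a (h : smoothFunctions ℝ) with hc
    have hzero : ((h - algebraMap ℂ 𝒜 c : 𝒜) : smoothFunctions ℝ).1 a = 0 := by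
      change evalPt a (h : smoothFunctions ℝ) - c = 0
      rw [hc, sub_self]
    obtain ⟨h', hh', hmul⟩ := h𝒜.div_mem _ (h - algebraMap ℂ 𝒜 c).2 a hzero
    have hh : h = algebraMap ℂ 𝒜 c + (h𝒜.coord - algebraMap ℂ 𝒜 (a : ℂ)) * ⟨h', hh'⟩ := by
      rw [← sub_eq_iff_eq_add']
      exact Subtype.ext (Subtype.ext (funext hmul))
    refine ⟨p + Polynomial.C c * (Polynomial.X - Polynomial.C (a : ℂ)) ^ M, ⟨h', hh'⟩, ?_⟩
    rw [hf, hh]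
    simp only [map_add, map_mul, map_pow, map_sub, Polynomial.aeval_X, Polynomial.aeval_C]
    ring

variable {A : FormalSymbol N} {Φ : 𝒜 →ₗ[ℂ] FormalSymbol N}

theorem IsFunctionalCalculus.map_coord_pow (hΦ : IsFunctionalCalculus 𝒜 A Φ)
    (h𝒜 : IsFunctionAlgebra 𝒜) (n : ℕ) : Φ (h𝒜.coord ^ n) = moyalPow A n := by
  induction n with
  | zero => rw [pow_zero, hΦ.map_one, moyalPow]
  | succ n ih =>
    rw [pow_succ, hΦ.map_mul, ih, moyalPow]
    congr 1
    exact hΦ.map_coord h𝒜.coord_mem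

/-- `Φ` turns the power into `M` Moyal factors `A - a`. Each vanishes to order one at `z`, as only
`A₀(z) = a` matters at that order; nothing is needed of `Φ h`. -/
theorem IsFunctionalCalculus.vanishesAt (hΦ : IsFunctionalCalculus 𝒜 A Φ)
    (h𝒜 : IsFunctionAlgebra 𝒜) {z : PhaseSpace N} {a : ℝ}
    (ha : evalPt z (PowerSeries.constantCoeff A) = a) (M : ℕ) (h : 𝒜) :
    VanishesAt z M (Φ ((h𝒜.coord - algebraMap ℂ 𝒜 (a : ℂ)) ^ M * h)) := by
  have h1 : VanishesAt z 1 (Φ (h𝒜.coord - algebraMap ℂ 𝒜 (a : ℂ))) := by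
    intro l j hlj
    obtain rfl : l = [] := List.eq_nil_of_length_eq_zero (by omega)
    obtain rfl : j = 0 := by omega
    rw [iterPderiv_nil, map_sub, Algebra.algebraMap_eq_smul_one, map_smul, hΦ.map_one,
      show Φ h𝒜.coord = A from hΦ.map_coord h𝒜.coord_mem, map_sub, PowerSeries.coeff_smul,
      map_sub, map_smul, PowerSeries.coeff_zero_one,
      PowerSeries.coeff_zero_eq_constantCoeff, ha, show evalPt z (1 : ClassicalSymbol N) = 1 from rfl,
      smul_eq_mul, mul_one, sub_self]
  induction M with
  | zero => exact fun l j hlj => absurd hlj (Nat.not_lt_zero _)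
  | succ M ih =>
    rw [pow_succ', mul_assoc, hΦ.map_mul, add_comm]
    exact h1.moyal ih

end FunctionalCalculus

theorem mainTheorem3 (N : ℕ) (𝒜 : Subalgebra ℂ (smoothFunctions ℝ)) (h𝒜 : IsFunctionAlgebra 𝒜)
    (A : FormalSymbol N)
    (hA : ∀ z : PhaseSpace N,
      (((PowerSeries.constantCoeff A : ClassicalSymbol N) : PhaseSpace N → ℂ) z).im = 0)
    (Φ : 𝒜 →ₗ[ℂ] FormalSymbol N) (hΦ : IsFunctionalCalculus 𝒜 A Φ)
    (rep : ∀ V E : ℕ, UnlabeledGraph V E → LabeledGraph V E)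
    (hrep : ∀ (V E : ℕ) (G : UnlabeledGraph V E),
      (Quotient.mk'' (rep V E G) : UnlabeledGraph V E) = G)
    (f : smoothFunctions ℝ) (hf : f ∈ 𝒜) :
    Φ ⟨f, hf⟩ = applyOperator (expOperator (connectedGraphSum rep A)) f A := by
  set T := applyOperatorLM (expOperator (connectedGraphSum rep A)) A with hT
  have hpoly : ∀ p : Polynomial ℂ,
      Φ (Polynomial.aeval h𝒜.coord p) = T (Polynomial.aeval h𝒜.coord p : 𝒜) := by
    intro p
    have hpow : ∀ n, T (((h𝒜.coord ^ n : 𝒜) : smoothFunctions ℝ)) = moyalPow A n :=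
      applyOperator_expOperator_coordFn_pow hrep hA
    induction p using Polynomial.induction_on' with
    | add p q hp hq => rw [map_add, map_add, hp, hq, Subalgebra.coe_add, map_add]
    | monomial n c =>
      rw [Polynomial.aeval_monomial, ← Algebra.smul_def, map_smul, hΦ.map_coord_pow h𝒜,
        Subalgebra.coe_smul, map_smul, hpow]
  change _ = T f
  ext1 n
  refine smoothFunctions_ext fun z => ?_
  set a : ℝ := (evalPt z (PowerSeries.constantCoeff A)).re with ha
  have haz : evalPt z (PowerSeries.constantCoeff A) = a :=
    Complex.ext rfl (by rw [Complex.ofReal_im]; exact hA z)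
  obtain ⟨M, hM⟩ := exists_evalPt_coeff_applyOperator_eq_zero
    (expOperator (connectedGraphSum rep A)) A z n
  -- The exponent is at least `M`, which kills the remainder under `T`, and exceeds `2n`, the weight
  -- of `ħⁿ`, which kills it under `Φ`.
  obtain ⟨p, h, hfp⟩ := h𝒜.exists_eq_aeval_add a (M + 2 * n + 1) ⟨f, hf⟩
  have hfp' : f = ((Polynomial.aeval h𝒜.coord p : 𝒜) : smoothFunctions ℝ) +
      (coordFn - algebraMap ℂ _ (a : ℂ)) ^ (M + 2 * n + 1) * h := congrArg Subtype.val hfp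
  have h1 : evalPt z (PowerSeries.coeff n (Φ ((h𝒜.coord - algebraMap ℂ 𝒜 (a : ℂ)) ^
      (M + 2 * n + 1) * h))) = 0 :=
    hΦ.vanishesAt h𝒜 haz (M + 2 * n + 1) h [] n (by rw [List.length_nil]; omega)
  have h2 : evalPt z (PowerSeries.coeff n (T ((coordFn - algebraMap ℂ _ (a : ℂ)) ^
      (M + 2 * n + 1) * (h : smoothFunctions ℝ)))) = 0 :=
    hM _ fun j hj => evalPt_iterate_derivFn_eq_zero a (by omega) _
  rw [hfp, map_add, map_add, map_add, h1, hpoly, hfp', map_add, map_add, map_add, h2]
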